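/- Assume $\diamondsuit$. Then there is an enumeration $\{C_\alpha\}_{\alpha<\omega_1}=[\omega_1]^{\le\omega}$ with $C_\alpha\subseteq\alpha$ for all $\alpha<\omega_1$, and there is a sequence $\{B_\gamma\}_{\gamma<\omega_1}$ of subsets of $[\omega_1]^{<\omega}$ that is a $\diamondsuit$-sequence on $[\omega_1]^{<\omega}$: for every uncountable $B\subseteq[\omega_1]^{<\omega}$ there are stationarily many $\beta<\omega_1$ with $B\cap[\beta]^{<\omega}=B_\beta$. Fix any such $\{C_\alpha\}$ and $\{B_\gamma\}$. For $Q\subseteq\mathbb R$ let $Q^*=\{H\in[\mathbb R]^{<\omega}:H\subseteq Q\}$, and let $\mathcal W=\{Q^*: Q$ is a disjoint union of finitely many open intervals with rational endpoints$\}$. Then there exist families $\{U^\alpha_\gamma\}_{\gamma\le\alpha}$ and maps $\varphi_\alpha:\alpha+1\to[\mathbb R]^{<\omega}$, for $\alpha<\omega_1$, with the following properties. **IH(1)** $U^\alpha_\gamma\subseteq\alpha+1$ and $U^\alpha_\alpha=\alpha+1$ for all $\gamma\le\alpha<\omega_1$; the sets $\varphi_\alpha(\gamma)$, $\gamma\le\alpha$,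 are nonempty, and $\varphi_\alpha(\gamma)\cap\varphi_\alpha(\gamma')=\emptyset$ for distinct $\gamma,\gamma'\le\alpha$. **IH(2)** $U^\alpha_\gamma=U^{\alpha_0}_\gamma\cap(\alpha+1)$ and $\varphi_\alpha=\varphi_{\alpha_0}\upharpoonright(\alpha+1)$ for all $\gamma\le\alpha\le\alpha_0<\omega_1$. Let $\tau_\alpha$ be the topology on $\alpha+1$ generated by the subbase $\{U^\alpha_\gamma:\gamma\le\alpha\}\cup\{\varphi_\alpha^{-1}(W):W\in\mathcal W\}$, and let $U^\alpha_F=\bigcap\{U^\alpha_\gamma:\gamma\in F\}$ for $F\in[\alpha+1]^{<\omega}$, with $U^\alpha_\emptyset=\alpha+1$. **IH(3)** For every $\alpha<\omega_1$, if $C_\alpha$ is $\tau_\alpha$-closed discrete, then $\bigcup\{U^\alpha_\gamma:\gamma\in C_\alpha\}\ne\alpha+1$. **IH(4)** For a cardinal $\vartheta$ let $H(\vartheta)$ be the set of all sets whose transitive closure has size less than $\vartheta$. Let $T_\alpha$ be the set of all $\beta\le\alpha$ such that $B_\beta$ is a pairwise disjoint family of finite subsets of $\beta$ and, for some cardinal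 $\vartheta$, there is a countable elementary submodel $M\prec H(\vartheta)$ satisfying (i)–(v): (i) $M\cap\omega_1=\beta$; (ii) $\mathcal W,\{B_\gamma\}_{\gamma<\omega_1}\in M$; (iii) there is a function $\varphi\in M$ with $\varphi\upharpoonright\beta=\varphi_\beta\upharpoonright\beta$; (iv) there is an uncountable $B\in M$ with $M\cap B=B_\beta$ (so that $\vartheta>\aleph_1$); (v) there is a sequence $\{V_\gamma\}_{\gamma<\omega_1}\in M$ with $V_\gamma\cap\beta=U^\beta_\gamma\cap\beta$ for all $\gamma<\beta$. Then for every $\alpha<\omega_1$: (a) if $\beta\in T_\alpha$, then $B_\beta$ is a local $\pi$-network at $\beta$ in $\tau_\alpha$, that is, every $\tau_\alpha$-open set containing $\beta$ includes some member of $B_\beta$; (b) if $\beta\in T_\alpha\cap\alpha$, then for every $V\in\tau_\alpha$ with $\beta\in V$ the family $\{U^\alpha_F:F\in B_\beta,\ F\subseteq V\}$ is an $\omega$-cover of $(\beta,\alpha]$, that is, every finite subset of $(\beta,\alpha]$ is contained in a member of the family. -/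

import Mathlib

open Set
open scoped Ordinal Topology

/-- The set `ω₁` of countable ordinals. For `α : OmegaOne`, the ordinal `α + 1 = {β | β ≤ α}` is
`Set.Iic α`, the ordinal `α = {β | β < α}` is `Set.Iio α`, and `(β, α]` is `Set.Ioc β α`. -/
abbrev OmegaOne : Type 1 := Set.Iio (ω₁ : Ordinal.{0})

/-! ### Combinatorial hypotheses -/

/-- Jensen's principle `◇`. -/
def DiamondPrinciple : Prop :=
  ∃ A : OmegaOne → Set OmegaOne,
    (∀ α, A α ⊆ Iio α) ∧ ∀ X : Set OmegaOne, IsStationary {α | X ∩ Iio α = A α}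

/-- `C` enumerates the countable subsets of `ω₁`, and `C α ⊆ α` for all `α < ω₁`. -/
def EnumeratesCountableSets (C : OmegaOne → Set OmegaOne) : Prop :=
  range C = {S | S.Countable} ∧ ∀ α, C α ⊆ Iio α

/-- `B` is a `◇`-sequence on `[ω₁]^{<ω}`: every uncountable `A ⊆ [ω₁]^{<ω}` satisfies
`A ∩ [β]^{<ω} = B β` for stationary many `β`. -/
def IsDiamondSequenceOnFinsets (B : OmegaOne → Set (Finset OmegaOne)) : Prop :=
  ∀ A : Set (Finset OmegaOne), ¬ A.Countable →
    IsStationary {β | A ∩ {F | (F : Set OmegaOne) ⊆ Iio β} = B β}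

/-! ### The topology of the space -/

/-- For `Q ⊆ ℝ`, the set `Q* = {H ∈ [ℝ]^{<ω} : H ⊆ Q}`. -/
def starSet (Q : Set ℝ) : Set (Finset ℝ) := {H | (H : Set ℝ) ⊆ Q}

/-- The open interval with the given rational endpoints. -/
def ratInterval (p : ℚ × ℚ) : Set ℝ := Ioo (p.1 : ℝ) (p.2 : ℝ)

/-- The countable base `𝒲` of `[ℝ]^{<ω}`: all `Q*`, where `Q` is a disjoint union of finitely many
open intervals with rational endpoints. -/
def baseW : Set (Set (Finset ℝ)) :=
  {W | ∃ s : Finset (ℚ × ℚ), (s : Set (ℚ × ℚ)).PairwiseDisjoint ratInterval ∧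
    W = starSet (⋃ p ∈ s, ratInterval p)}

/-- The topology `τ_α` on `α + 1`, with subbase
`{U^α_γ : γ ≤ α} ∪ {φ_α⁻¹(W) : W ∈ 𝒲}`. Here `U α γ` stands for `U^α_γ` and `φ α γ` for
`φ_α(γ)`; only the values with `γ ≤ α` are used. -/
@[reducible] def tau (U : OmegaOne → OmegaOne → Set OmegaOne) (φ : OmegaOne → OmegaOne → Finset ℝ)
    (α : OmegaOne) : TopologicalSpace (Iic α) :=
  TopologicalSpace.generateFrom
    ({S | ∃ γ ≤ α, S = {x : Iic α | (x : OmegaOne) ∈ U α γ}} ∪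
     {S | ∃ W ∈ baseW, S = {x : Iic α | φ α x ∈ W}})

/-- `U^α_F = ⋂ {U^α_γ : γ ∈ F}`, a subset of `α + 1` (equal to `α + 1` for `F = ∅`). -/
def interU (U : OmegaOne → OmegaOne → Set OmegaOne) (α : OmegaOne) (F : Finset OmegaOne) :
    Set OmegaOne :=
  {x | x ≤ α ∧ ∀ γ ∈ F, x ∈ U α γ}

/-- A closed discrete subset of a space. -/
def IsClosedDiscrete {X : Type*} (t : TopologicalSpace X) (S : Set X) : Prop :=
  IsClosed[t] S ∧ @IsDiscrete X t S

/-- A local `π`-network at the point `x`. -/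
def IsLocalPiNetwork {X : Type*} (t : TopologicalSpace X) (𝒩 : Set (Set X)) (x : X) : Prop :=
  ∀ V : Set X, IsOpen[t] V → x ∈ V → ∃ N ∈ 𝒩, N ⊆ V

/-- `𝒰` is an `ω`-cover of `Y`: every finite subset of `Y` is contained in a member of `𝒰`. -/
def IsOmegaCover {X : Type*} (𝒰 : Set (Set X)) (Y : Set X) : Prop :=
  ∀ G : Finset X, (G : Set X) ⊆ Y → ∃ V ∈ 𝒰, (G : Set X) ⊆ V

/-! ### Elementary submodels of `H(θ)` -/

/-- The only symbol of the language of set theory. -/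
inductive MemSymbol : ℕ → Type
  | mem : MemSymbol 2

/-- The first-order language of set theory, with one binary relation symbol. -/
def setLanguage : FirstOrder.Language.{0, 0} := ⟨fun _ => Empty, MemSymbol⟩

/-- `H(θ)`: the sets whose transitive closure has size less than `θ`. -/
def HSets (θ : Cardinal.{0}) : Set ZFSet.{0} :=
  {x | Cardinal.mk {y : ZFSet.{0} // Relation.TransGen (· ∈ ·) y x} < Cardinal.lift.{1} θ}

/-- `H(θ)` as a structure for the language of set theory, under the true membership relation. -/
instance instStructureHSets (θ : Cardinal.{0}) : setLanguage.Structure (HSets θ) where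
  funMap := fun f => Empty.elim f
  RelMap := fun r =>
    match r with
    | MemSymbol.mem => fun v => (v 0 : ZFSet.{0}) ∈ (v 1 : ZFSet.{0})

/-- The sets that belong to an elementary submodel `M ≺ H(θ)`. -/
def modelSets {θ : Cardinal.{0}} (M : setLanguage.ElementarySubstructure (HSets θ)) :
    Set ZFSet.{0} :=
  Subtype.val '' (M : Set (HSets θ))

/-! ### The objects of the construction as sets -/

instance instSmallFinsetOmegaOne : Small.{0} (Finset OmegaOne) :=
  small_of_injective (f := fun F : Finset OmegaOne => (F : Set OmegaOne)) Finset.coe_injective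

/-- The set `{c a : a ∈ s}`. -/
noncomputable def codeSet {A : Type*} [Small.{0} A] (c : A → ZFSet.{0}) (s : Set A) : ZFSet.{0} :=
  ZFSet.range (fun a : s => c a)

/-- A countable ordinal as a von Neumann ordinal. -/
noncomputable def codeOrd (γ : OmegaOne) : ZFSet.{0} := (γ : Ordinal.{0}).toZFSet

/-- A natural number as a von Neumann ordinal. -/
noncomputable def codeNat (n : ℕ) : ZFSet.{0} := (n : Ordinal.{0}).toZFSet

/-- The rational number `±m / d` in lowest terms as the triple of the positive part and the negative
part of its numerator and its denominator. -/
noncomputable def codeRat (q : ℚ) : ZFSet.{0} :=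
  ZFSet.pair (codeNat q.num.toNat) (ZFSet.pair (codeNat (-q.num).toNat) (codeNat q.den))

/-- A real number as a Dedekind cut. -/
noncomputable def codeReal (x : ℝ) : ZFSet.{0} := codeSet codeRat {q : ℚ | (q : ℝ) < x}

/-- A finite set of reals. -/
noncomputable def codeRealFinset (H : Finset ℝ) : ZFSet.{0} := codeSet codeReal (H : Set ℝ)

/-- A finite set of countable ordinals. -/
noncomputable def codeOrdFinset (F : Finset OmegaOne) : ZFSet.{0} :=
  codeSet codeOrd (F : Set OmegaOne)

/-- The base `𝒲` as a set. -/
noncomputable def codeBaseW : ZFSet.{0} := codeSet (codeSet codeRealFinset) baseW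

/-- The sequence `{B_γ}_{γ < ω₁}` as a set, namely the function `γ ↦ B_γ` with domain `ω₁`. -/
noncomputable def codeSequence (B : OmegaOne → Set (Finset OmegaOne)) : ZFSet.{0} :=
  ZFSet.range (fun γ : OmegaOne => ZFSet.pair (codeOrd γ) (codeSet codeOrdFinset (B γ)))

/-- Conditions (i)-(v) on an elementary submodel `M ≺ H(θ)`, relative to `β < ω₁`. -/
structure WitnessesAt (B : OmegaOne → Set (Finset OmegaOne))
    (U : OmegaOne → OmegaOne → Set OmegaOne) (φ : OmegaOne → OmegaOne → Finset ℝ)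
    (β : OmegaOne) {θ : Cardinal.{0}} (M : setLanguage.ElementarySubstructure (HSets θ)) :
    Prop where
  /-- `M ∩ ω₁ = β`. -/
  inter_omegaOne : modelSets M ∩ {x | x ∈ (ω₁ : Ordinal.{0}).toZFSet} = {x | x ∈ codeOrd β}
  /-- `𝒲 ∈ M`. -/
  baseW_mem : codeBaseW ∈ modelSets M
  /-- `{B_γ}_{γ < ω₁} ∈ M`. -/
  sequence_mem : codeSequence B ∈ modelSets M
  /-- Some function `f ∈ M` satisfies `f ↾ β = φ_β ↾ β`. -/
  exists_function : ∃ f ∈ modelSets M, (∃ X Y : ZFSet.{0}, ZFSet.IsFunc X Y f) ∧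
    ∀ γ < β, ZFSet.pair (codeOrd γ) (codeRealFinset (φ β γ)) ∈ f
  /-- Some uncountable `A ∈ M` satisfies `M ∩ A = B_β`. -/
  exists_uncountable : ∃ A ∈ modelSets M, ¬ {x | x ∈ A}.Countable ∧
    modelSets M ∩ {x | x ∈ A} = codeOrdFinset '' B β
  /-- Some sequence `{V_γ}_{γ < ω₁} ∈ M` satisfies `V_γ ∩ β = U^β_γ ∩ β` for all `γ < β`. -/
  exists_sequence : ∃ v ∈ modelSets M,
    (∃ Y : ZFSet.{0}, ZFSet.IsFunc (ω₁ : Ordinal.{0}).toZFSet Y v) ∧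
    ∀ γ < β, ∃ w : ZFSet.{0}, ZFSet.pair (codeOrd γ) w ∈ v ∧
      ∀ δ < β, (codeOrd δ ∈ w ↔ δ ∈ U β γ)

/-- The set `T_α` of all `β ≤ α` such that `B_β` is a pairwise disjoint family of finite subsets of
`β` and some countable `M ≺ H(θ)`, for some `θ`, satisfies (i)-(v). No largeness of `θ` needs to be
demanded: an uncountable set in `H(θ)` forces `θ > ℵ₁`, and to admit every `θ` only makes `T_α`
larger, hence every assertion about all elements of `T_α` stronger. -/
def guessedPoints (B : OmegaOne → Set (Finset OmegaOne))
    (U : OmegaOne → OmegaOne → Set OmegaOne) (φ : OmegaOne → OmegaOne → Finset ℝ)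
    (α : OmegaOne) : Set OmegaOne :=
  {β | β ≤ α ∧ (B β).PairwiseDisjoint id ∧ (∀ F ∈ B β, (F : Set OmegaOne) ⊆ Iio β) ∧
    ∃ (θ : Cardinal.{0}) (M : setLanguage.ElementarySubstructure (HSets θ)),
      (modelSets M).Countable ∧ WitnessesAt B U φ β M}

/-!
The sets `φ(α)` and `{γ < α : α ∈ U_γ}` are chosen by recursion on `α < ω₁`; they determine
`U^α_γ = U_γ ∩ (α + 1)` and `τ_α`. As `U_γ` contains `γ + 1`, the restriction of `τ_α` to `β + 1` is
`τ_β`, so at stage `α` only the new point has to be dealt with, and everything is expressed by the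
basic sets `⋂ {U_γ : γ ∈ K} ∩ φ⁻¹(Q*)` with `K` finite and `Q ⊆ ℝ` open (`IsCorrectAt`).

The heart of the matter is a guessed point `α`, with witness `M` (`exists_generic_point`). Let `A`,
`f`, `v` in `M` be the uncountable set with `M ∩ A = B_α` and the sequences extending `φ ↾ α` and
`{U_γ ∩ α}_{γ < α}`. As `A` is uncountable and `M` is countable, there is `F* ∈ A \ M`. By
elementarity the members of `A` are pairwise disjoint finite sets of countable ordinals, so
`F* ∩ α = ∅`. Put `φ(α) = ⋃ {f(x) : x ∈ F*}` and let `D` consist of the `γ < α` with `F* ⊆ v(γ)`. If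
`K ⊆ D` is finite and `φ(α) ⊆ Q`, then `F*` satisfies `F* ⊆ v(γ)` for all `γ ∈ K` and `f(x) ⊆ Q` for
all `x ∈ F*`; by elementarity some `F ∈ M ∩ A = B_α` does, so `B_α` is a local `π`-network at `α` if
`α` is put into no `U_γ` with `γ ∉ D`. On the other hand, let `β < α` be a guessed point, `V` a basic
set with `β ∈ V`, and `G ⊆ (β, α)` finite. The `ω`-cover property below `α` says that for all
`E ∈ M ∩ A` above `β` there is `F ∈ B_β` with `F ⊆ V` and `E ∪ G ⊆ U_F`. By elementarity this holds
with `v` in place of `U` for `E = F*` too, which gives `F ∈ B_β` with `F ⊆ V ∩ D` and `G ⊆ U_F`. So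
if `α` is put into `U_γ` for all `γ ∈ D`, the `ω`-cover property extends to `(β, α]`.

Finally, if every point below `α` has a neighbourhood that meets `C_α` in at most that point, `D` is
replaced by `D \ C_α` (`IsCorrectAt.exists_update`). The argument for `β` still works, with `V` so
small that `V ∩ C_α ⊆ {β}`: the members of `B_β` are subsets of `β`, so those inside `V` miss `C_α`.
Hence `α` is not covered by `{U_γ : γ ∈ C_α}`.

Elementarity is only used in the form of the Tarski–Vaught criterion (`DefinableOver.exists_mem`),
and of `H(θ)` only its transitivity is needed. Finiteness need not be expressed by a formula: a
finite set of reals is a member of a member of `𝒲`, and a finite subset of `ω₁` is a member of some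
`B_β`, because the `◇`-sequence guesses `[ω₁]^{<ω}` itself unboundedly often.
-/

/-! ### Countable ordinals and the two consequences of `◇` -/

namespace OmegaOne

theorem countable_Iio (a : OmegaOne) : (Iio a).Countable := by
  have h : (Iio (a : Ordinal.{0})).Countable := by
    rw [← Cardinal.le_aleph0_iff_set_countable, Cardinal.mk_Iio_ordinal,
      Cardinal.lift_le_aleph0, ← Cardinal.lt_aleph_one_iff]
    have h1 : (a : Ordinal.{0}) < ω₁ := a.2
    have h2 : ω₁ = (Cardinal.aleph 1).ord := (Cardinal.ord_aleph 1).symm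
    exact Cardinal.lt_ord.1 (h1.trans_eq h2)
  refine (h.preimage (f := fun x : OmegaOne => (x : Ordinal.{0})) Subtype.val_injective).mono ?_
  intro x hx
  exact hx

/-- The cofinality of `ω₁` is uncountable. -/
theorem exists_forall_lt {s : Set OmegaOne} (hs : s.Countable) : ∃ b, ∀ x ∈ s, x < b := by
  have : Countable s := hs
  have h := Ordinal.iSup_lt_omega_one (f := fun x : s => Order.succ ((x : OmegaOne) : Ordinal.{0}))
    (fun x => (Cardinal.isSuccLimit_omega 1).succ_lt x.1.2)
  refine ⟨⟨_, h⟩, fun x hx => ?_⟩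
  have h1 := Ordinal.le_iSup (fun x : s => Order.succ ((x : OmegaOne) : Ordinal.{0})) ⟨x, hx⟩
  exact (Order.lt_succ (x : Ordinal.{0})).trans_le h1

theorem not_countable_univ : ¬ (univ : Set OmegaOne).Countable := fun h => by
  obtain ⟨b, hb⟩ := exists_forall_lt h
  exact lt_irrefl b (hb b (mem_univ b))

instance instInfinite : Infinite OmegaOne := by
  by_contra h
  rw [not_infinite_iff_finite] at h
  exact not_countable_univ (toFinite _).countable

theorem isClub_Ici (a : OmegaOne) : IsClub (Ici a) where
  dirSupClosed := by
    intro s hs hne _ b hb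
    obtain ⟨x, hx⟩ := hne
    exact (hs hx : a ≤ x).trans (hb.1 hx)
  isCofinal x := ⟨max a x, mem_Ici.2 (le_max_left _ _), le_max_right _ _⟩

theorem cof_ne_aleph0 : Order.cof OmegaOne ≠ Cardinal.aleph0 := by
  have h : Order.cof OmegaOne = Cardinal.aleph 1 := by simp
  rw [h]
  exact Cardinal.aleph0_lt_aleph_one.ne'

theorem countable_finsets_subset {s : Set OmegaOne} (hs : s.Countable) :
    {F : Finset OmegaOne | (F : Set OmegaOne) ⊆ s}.Countable := by
  refine ((countable_ofPred_finite_subset hs).preimage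
    (f := fun F : Finset OmegaOne => (F : Set OmegaOne)) Finset.coe_injective).mono ?_
  intro F hF
  exact ⟨F.finite_toSet, hF⟩

theorem exists_finset_subset_Iio (F : Finset OmegaOne) :
    ∃ b, (F : Set OmegaOne) ⊆ Iio b :=
  exists_forall_lt F.countable_toSet

end OmegaOne

theorem IsStationary.inter_isClub {s t : Set OmegaOne} (hs : IsStationary s) (ht : IsClub t) :
    IsStationary (s ∩ t) := fun u hu => by
  rw [inter_assoc]
  exact hs (ht.inter OmegaOne.cof_ne_aleph0 hu)

/-- A `◇`-sequence already lists all countable subsets of `ω₁`: a bounded set `S` is guessed at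
some `α` above all its elements, where `S ∩ α = S`. -/
theorem DiamondPrinciple.exists_enumeratesCountableSets (h : DiamondPrinciple) :
    ∃ C : OmegaOne → Set OmegaOne, EnumeratesCountableSets C := by
  obtain ⟨A, hA, hst⟩ := h
  refine ⟨A, Subset.antisymm ?_ ?_, hA⟩
  · rintro _ ⟨α, rfl⟩
    exact (OmegaOne.countable_Iio α).mono (hA α)
  · intro S hS
    obtain ⟨b, hb⟩ := OmegaOne.exists_forall_lt hS
    obtain ⟨α, hα, hbα⟩ := hst S (OmegaOne.isClub_Ici b)
    refine ⟨α, ?_⟩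
    rw [← hα, inter_eq_left]
    exact fun x hx => (hb x hx).trans_le hbα

/-- For a bijection `e` of `ω₁` with `[ω₁]^{<ω}`, club many `β` satisfy `e[β] = [β]^{<ω}`. -/
theorem isClub_image_Iio_eq (e : OmegaOne ≃ Finset OmegaOne) :
    IsClub {β : OmegaOne | e '' Iio β = {F : Finset OmegaOne | (F : Set OmegaOne) ⊆ Iio β}} where
  dirSupClosed := by
    intro s hs hne hdir a ha
    have hlt : ∀ x < a, ∃ b ∈ s, x < b := fun x hx => by
      by_contra! hcon
      exact absurd (ha.2 hcon) (not_le.2 hx)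
    refine Subset.antisymm ?_ ?_
    · rintro _ ⟨x, hx, rfl⟩
      obtain ⟨b, hb, hxb⟩ := hlt x hx
      have : e x ∈ e '' Iio b := mem_image_of_mem e hxb
      rw [hs hb] at this
      exact fun y hy => (this hy).trans_le (ha.1 hb)
    · intro F hF
      obtain ⟨b, hb, hFb⟩ : ∃ b ∈ s, (F : Set OmegaOne) ⊆ Iio b := by
        rcases F.eq_empty_or_nonempty with rfl | hFne
        · obtain ⟨b, hb⟩ := hne
          exact ⟨b, hb, by simp⟩
        · obtain ⟨b, hb, hFb⟩ := hlt _ (hF (F.max'_mem hFne))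
          exact ⟨b, hb, fun y hy => (F.le_max' y hy).trans_lt hFb⟩
      have : F ∈ e '' Iio b := by rw [hs hb]; exact hFb
      obtain ⟨x, hx, rfl⟩ := this
      exact ⟨x, lt_of_lt_of_le hx (ha.1 hb), rfl⟩
  isCofinal a := by
    have hg : ∀ b : OmegaOne, ∃ c, b < c ∧ (∀ x < b, (e x : Set OmegaOne) ⊆ Iio c) ∧
        ∀ F : Finset OmegaOne, (F : Set OmegaOne) ⊆ Iio b → e.symm F < c := fun b => by
      have h1 : (⋃ x ∈ Iio b, (e x : Set OmegaOne)).Countable :=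
        (OmegaOne.countable_Iio b).biUnion fun x _ => (e x).countable_toSet
      have h2 := (OmegaOne.countable_finsets_subset (OmegaOne.countable_Iio b)).image e.symm
      obtain ⟨c, hc⟩ := OmegaOne.exists_forall_lt ((h1.union h2).union (countable_singleton b))
      refine ⟨c, hc b (by simp), fun x hx y hy => hc y ?_, fun F hF => hc _ ?_⟩
      · exact Or.inl (Or.inl (mem_biUnion (show x ∈ Iio b from hx) hy))
      · exact Or.inl (Or.inr (mem_image_of_mem _ hF))
    choose g hg1 hg2 hg3 using hg
    let u : ℕ → OmegaOne := fun n => g^[n] a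
    have hu : ∀ n, u (n + 1) = g (u n) := fun n => Function.iterate_succ_apply' g n a
    have hub : (upperBounds (range u)).Nonempty := by
      obtain ⟨c, hc⟩ := OmegaOne.exists_forall_lt (countable_range u)
      exact ⟨c, fun x hx => (hc x hx).le⟩
    obtain ⟨s, hs, hmin⟩ := WellFounded.has_min wellFounded_lt _ hub
    have hle : ∀ n, u n ≤ s := fun n => hs (mem_range_self n)
    have hlt : ∀ x < s, ∃ n, x < u n := fun x hx => by
      by_contra! hcon
      exact hmin x (by rintro _ ⟨n, rfl⟩; exact hcon n) hx
    refine ⟨s, Subset.antisymm ?_ ?_, hle 0⟩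
    · rintro _ ⟨x, hx, rfl⟩
      obtain ⟨n, hn⟩ := hlt x hx
      intro y hy
      have := hg2 _ x hn hy
      rw [← hu] at this
      exact lt_of_lt_of_le this (hle _)
    · intro F hF
      obtain ⟨n, hFn⟩ : ∃ n, (F : Set OmegaOne) ⊆ Iio (u n) := by
        rcases F.eq_empty_or_nonempty with rfl | hFne
        · exact ⟨0, by simp⟩
        · obtain ⟨n, hn⟩ := hlt _ (hF (F.max'_mem hFne))
          exact ⟨n, fun y hy => (F.le_max' y hy).trans_lt hn⟩
      refine ⟨e.symm F, ?_, by simp⟩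
      have := hg3 _ F hFn
      rw [← hu] at this
      exact lt_of_lt_of_le this (hle _)

theorem DiamondPrinciple.exists_isDiamondSequenceOnFinsets (h : DiamondPrinciple) :
    ∃ B : OmegaOne → Set (Finset OmegaOne), IsDiamondSequenceOnFinsets B := by
  obtain ⟨A, hA, hst⟩ := h
  obtain ⟨e⟩ : Nonempty (OmegaOne ≃ Finset OmegaOne) :=
    Cardinal.eq.1 (Cardinal.mk_finset_of_infinite OmegaOne).symm
  refine ⟨fun β => e '' A β, fun X _ => ?_⟩
  refine ((hst (e ⁻¹' X)).inter_isClub (isClub_image_Iio_eq e)).mono ?_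
  rintro β ⟨h1, h2⟩
  simp only [mem_ofPred_eq] at h1 h2 ⊢
  rw [← h2, ← h1, image_preimage_inter]

/-- The diamond sequence guesses all of `[ω₁]^{<ω}` unboundedly often, so every finite subset of
`ω₁` belongs to some `B_β`. -/
theorem IsDiamondSequenceOnFinsets.exists_mem {B : OmegaOne → Set (Finset OmegaOne)}
    (hB : IsDiamondSequenceOnFinsets B) (F : Finset OmegaOne) : ∃ β, F ∈ B β := by
  have hunc : ¬ (univ : Set (Finset OmegaOne)).Countable := fun h =>
    OmegaOne.not_countable_univ <| by
      simpa using h.preimage (f := fun x : OmegaOne => ({x} : Finset OmegaOne))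
        (fun x y hxy => by simpa using hxy)
  obtain ⟨b, hb⟩ := OmegaOne.exists_finset_subset_Iio F
  obtain ⟨β, hβ, hbβ⟩ := hB univ hunc (OmegaOne.isClub_Ici b)
  refine ⟨β, ?_⟩
  rw [← (show _ = B β from hβ)]
  exact ⟨mem_univ _, fun x hx => mem_Iio.2 (lt_of_lt_of_le (hb hx) hbβ)⟩

/-! ### Definability over an elementary submodel -/

section Definability

open FirstOrder FirstOrder.Language

variable {θ : Cardinal.{0}}

theorem HSets.mem_of_mem {x y : ZFSet.{0}} (hy : y ∈ HSets θ) (hxy : x ∈ y) : x ∈ HSets θ := by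
  refine lt_of_le_of_lt ?_ (show Cardinal.mk {z : ZFSet.{0} // Relation.TransGen (· ∈ ·) z y} < Cardinal.lift.{1} θ from
      hy)
  refine Cardinal.mk_le_of_injective
    (f := fun z : {z : ZFSet.{0} // Relation.TransGen (· ∈ ·) z x} =>
      (⟨z.1, z.2.tail hxy⟩ : {z : ZFSet.{0} // Relation.TransGen (· ∈ ·) z y})) ?_
  intro a b hab
  exact Subtype.ext (Subtype.mk.inj hab)

variable (M : setLanguage.ElementarySubstructure (HSets θ)) {ι : Type}

/-- The predicate `P` on tuples from `H(θ)` is first-order definable with parameters from `M`.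
Finite index types `ι` of the form `Option (Option …)` serve as contexts of free variables. -/
def DefinableOver (P : (ι → HSets θ) → Prop) : Prop :=
  ∃ f : setLanguage.Formula (M ⊕ ι),
    ∀ v, f.Realize (Sum.elim (fun m : M => (m : HSets θ)) v) ↔ P v

/-- `t` is a coordinate or a constant from `M`. -/
def IsTermOver (t : (ι → HSets θ) → HSets θ) : Prop :=
  ∃ s : M ⊕ ι, ∀ v, t v = Sum.elim (fun m : M => (m : HSets θ)) v s

variable {M}

namespace IsTermOver

theorem var (i : ι) : IsTermOver M (fun v => v i) := ⟨Sum.inr i, fun _ => rfl⟩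

theorem const {m : HSets θ} (hm : m ∈ M) : IsTermOver M (fun _ : ι → HSets θ => m) :=
  ⟨Sum.inl ⟨m, hm⟩, fun _ => rfl⟩

theorem weaken {t : (ι → HSets θ) → HSets θ} (ht : IsTermOver M t) :
    IsTermOver M (fun w : Option ι → HSets θ => t (fun i => w (some i))) := by
  obtain ⟨s, hs⟩ := ht
  refine ⟨Sum.map id some s, fun v => (hs _).trans ?_⟩
  cases s <;> rfl

end IsTermOver

namespace DefinableOver

variable {P Q : (ι → HSets θ) → Prop} {t₁ t₂ t₃ : (ι → HSets θ) → HSets θ}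

theorem congr (h : DefinableOver M P) (hPQ : ∀ v, Q v ↔ P v) : DefinableOver M Q := by
  obtain ⟨f, hf⟩ := h
  exact ⟨f, fun v => (hf v).trans (hPQ v).symm⟩

theorem not (h : DefinableOver M P) : DefinableOver M (fun v => ¬ P v) := by
  obtain ⟨f, hf⟩ := h
  exact ⟨f.not, fun v => by rw [Formula.realize_not, hf]⟩

theorem and (h : DefinableOver M P) (h' : DefinableOver M Q) :
    DefinableOver M (fun v => P v ∧ Q v) := by
  obtain ⟨f, hf⟩ := h
  obtain ⟨g, hg⟩ := h'
  exact ⟨f ⊓ g, fun v => by rw [Formula.realize_inf, hf, hg]⟩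

theorem or (h : DefinableOver M P) (h' : DefinableOver M Q) :
    DefinableOver M (fun v => P v ∨ Q v) := by
  obtain ⟨f, hf⟩ := h
  obtain ⟨g, hg⟩ := h'
  exact ⟨f ⊔ g, fun v => by rw [Formula.realize_sup, hf, hg]⟩

theorem imp (h : DefinableOver M P) (h' : DefinableOver M Q) :
    DefinableOver M (fun v => P v → Q v) := by
  obtain ⟨f, hf⟩ := h
  obtain ⟨g, hg⟩ := h'
  exact ⟨f.imp g, fun v => by rw [Formula.realize_imp, hf, hg]⟩

theorem ex {R : (ι → HSets θ) → HSets θ → Prop}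
    (h : DefinableOver M (fun w : Option ι → HSets θ => R (fun i => w (some i)) (w none))) :
    DefinableOver M (fun v => ∃ x, R v x) := by
  obtain ⟨f, hf⟩ := h
  let g : M ⊕ Option ι → (M ⊕ ι) ⊕ Unit :=
    Sum.elim (fun m => Sum.inl (Sum.inl m))
      (fun o => o.elim (Sum.inr ()) (fun i => Sum.inl (Sum.inr i)))
  refine ⟨Formula.iExs Unit (f.relabel g), fun v => ?_⟩
  rw [Formula.realize_iExs]
  have key : ∀ x : Unit → HSets θ,
      (f.relabel g).Realize (Sum.elim (Sum.elim (fun m : M => (m : HSets θ)) v) x) ↔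
        R v (x ()) := fun x => by
    rw [Formula.realize_relabel]
    have := hf (fun o => o.elim (x ()) v)
    refine Iff.trans (iff_of_eq (congrArg f.Realize ?_)) this
    funext s
    rcases s with m | (_ | i) <;> rfl
  simp only [key]
  exact ⟨fun ⟨x, hx⟩ => ⟨_, hx⟩, fun ⟨x, hx⟩ => ⟨fun _ => x, hx⟩⟩

theorem all {R : (ι → HSets θ) → HSets θ → Prop}
    (h : DefinableOver M (fun w : Option ι → HSets θ => R (fun i => w (some i)) (w none))) :
    DefinableOver M (fun v => ∀ x, R v x) :=
  (h.not.ex (R := fun v x => ¬ R v x)).not.congr fun v => by simp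

theorem eq (h₁ : IsTermOver M t₁) (h₂ : IsTermOver M t₂) :
    DefinableOver M (fun v => t₁ v = t₂ v) := by
  obtain ⟨s₁, hs₁⟩ := h₁
  obtain ⟨s₂, hs₂⟩ := h₂
  refine ⟨Term.equal (Term.var s₁) (Term.var s₂), fun v => ?_⟩
  simp only [Formula.realize_equal, hs₁, hs₂]
  rfl

theorem mem (h₁ : IsTermOver M t₁) (h₂ : IsTermOver M t₂) :
    DefinableOver M (fun v => (t₁ v : ZFSet.{0}) ∈ (t₂ v : ZFSet.{0})) := by
  obtain ⟨s₁, hs₁⟩ := h₁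
  obtain ⟨s₂, hs₂⟩ := h₂
  let r : setLanguage.Relations 2 := MemSymbol.mem
  refine ⟨r.formula₂ (Term.var s₁) (Term.var s₂), fun v => ?_⟩
  simp only [Formula.realize_rel₂, hs₁, hs₂]
  rfl

theorem true : DefinableOver M (fun _ : ι → HSets θ => True) :=
  ⟨⊤, fun v => by simp⟩

/-- A finite conjunction, formed outside the language. -/
theorem ball_finset {κ : Type*} (s : Finset κ) {R : κ → (ι → HSets θ) → Prop}
    (h : ∀ i ∈ s, DefinableOver M (R i)) : DefinableOver M (fun v => ∀ i ∈ s, R i v) := by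
  classical
  induction s using Finset.induction_on with
  | empty => exact true.congr fun v => by simp
  | insert a s _ ih =>
    exact ((h a (by simp)).and (ih fun i hi => h i (by simp [hi]))).congr fun v => by simp

/-- A finite disjunction, formed outside the language. -/
theorem bex_finset {κ : Type*} (s : Finset κ) {R : κ → (ι → HSets θ) → Prop}
    (h : ∀ i ∈ s, DefinableOver M (R i)) : DefinableOver M (fun v => ∃ i ∈ s, R i v) :=
  (ball_finset s fun i hi => (h i hi).not).not.congr fun v => by simp

theorem eq_unorderedPair (h₁ : IsTermOver M t₁) (h₂ : IsTermOver M t₂) (h₃ : IsTermOver M t₃) :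
    DefinableOver M (fun v => (t₃ v : ZFSet.{0}) = {(t₁ v : ZFSet.{0}), (t₂ v : ZFSet.{0})}) := by
  refine DefinableOver.congr (((mem h₁ h₃).and (mem h₂ h₃)).and (all (R := fun v x =>
    (x : ZFSet.{0}) ∈ (t₃ v : ZFSet.{0}) → x = t₁ v ∨ x = t₂ v) (imp (mem (.var none) h₃.weaken)
      (or (eq (.var none) h₁.weaken) (eq (.var none) h₂.weaken))))) fun v => ?_
  constructor
  · intro h
    rw [h]
    refine ⟨⟨by simp, by simp⟩, fun x hx => ?_⟩
    simpa [Subtype.ext_iff] using hx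
  · rintro ⟨⟨h1, h2⟩, h3⟩
    ext z
    rw [ZFSet.mem_pair]
    refine ⟨fun hz => ?_, ?_⟩
    · simpa [Subtype.ext_iff] using h3 ⟨z, HSets.mem_of_mem (t₃ v).2 hz⟩ hz
    · rintro (rfl | rfl) <;> assumption

/-- Ordered pairs are absolute between `H(θ)` and the universe, since `H(θ)` is transitive. -/
theorem eq_pair (h₁ : IsTermOver M t₁) (h₂ : IsTermOver M t₂) (h₃ : IsTermOver M t₃) :
    DefinableOver M (fun v => (t₃ v : ZFSet.{0}) = ZFSet.pair (t₁ v) (t₂ v)) := by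
  refine DefinableOver.congr (ex (R := fun v a => ∃ b : HSets θ,
    (a : ZFSet.{0}) = {(t₁ v : ZFSet.{0}), (t₁ v : ZFSet.{0})} ∧
    (b : ZFSet.{0}) = {(t₁ v : ZFSet.{0}), (t₂ v : ZFSet.{0})} ∧
    (t₃ v : ZFSet.{0}) = {(a : ZFSet.{0}), (b : ZFSet.{0})}) (ex (and
      (eq_unorderedPair h₁.weaken.weaken h₁.weaken.weaken (.var _))
      (and (eq_unorderedPair h₁.weaken.weaken h₂.weaken.weaken (.var _))
        (eq_unorderedPair (.var _) (.var _) h₃.weaken.weaken))))) fun v => ?_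
  constructor
  · intro h
    have ha : ({(t₁ v : ZFSet.{0}), (t₁ v : ZFSet.{0})} : ZFSet.{0}) ∈ (t₃ v : ZFSet.{0}) := by
      rw [h]; simp [ZFSet.pair]
    have hb : ({(t₁ v : ZFSet.{0}), (t₂ v : ZFSet.{0})} : ZFSet.{0}) ∈ (t₃ v : ZFSet.{0}) := by
      rw [h]; simp [ZFSet.pair]
    exact ⟨⟨_, HSets.mem_of_mem (t₃ v).2 ha⟩, ⟨_, HSets.mem_of_mem (t₃ v).2 hb⟩, rfl, rfl,
      h.trans (by simp [ZFSet.pair])⟩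
  · rintro ⟨a, b, ha, hb, h⟩
    rw [h, ha, hb]
    simp [ZFSet.pair]

theorem pair_mem (h₁ : IsTermOver M t₁) (h₂ : IsTermOver M t₂) (h₃ : IsTermOver M t₃) :
    DefinableOver M (fun v => ZFSet.pair (t₁ v) (t₂ v) ∈ (t₃ v : ZFSet.{0})) := by
  refine DefinableOver.congr (ex (R := fun v p => (p : ZFSet.{0}) ∈ (t₃ v : ZFSet.{0}) ∧
    (p : ZFSet.{0}) = ZFSet.pair (t₁ v) (t₂ v)) (and (mem (.var _) h₃.weaken)
      (eq_pair h₁.weaken h₂.weaken (.var _)))) fun v => ?_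
  constructor
  · exact fun h => ⟨⟨_, HSets.mem_of_mem (t₃ v).2 h⟩, h, rfl⟩
  · rintro ⟨p, hp, h⟩
    rwa [← h]

/-- The Tarski–Vaught criterion: a definable property that holds somewhere in `H(θ)` holds
somewhere in `M`. -/
theorem exists_mem {P : HSets θ → Prop} (h : DefinableOver M (fun v : Unit → HSets θ => P (v ())))
    (hP : ∃ x, P x) : ∃ x ∈ M, P x := by
  obtain ⟨f, hf⟩ := h
  obtain ⟨x, hx⟩ := hP
  have h1 : (Formula.iExs Unit f).Realize (fun m : M => M.subtype m) := by
    rw [Formula.realize_iExs]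
    exact ⟨fun _ => x, (hf _).2 hx⟩
  have h2 := (M.subtype.map_formula (Formula.iExs Unit f) (fun m : M => m)).1 h1
  rw [Formula.realize_iExs] at h2
  obtain ⟨y, hy⟩ := h2
  rw [← M.subtype.map_formula] at hy
  refine ⟨y (), (y ()).2, (hf (fun _ => (y () : HSets θ))).1 ?_⟩
  convert hy using 1
  funext s
  rcases s with m | i <;> rfl

theorem forall_of_mem {P : HSets θ → Prop}
    (h : DefinableOver M (fun v : Unit → HSets θ => P (v ()))) (hP : ∀ x ∈ M, P x) (x : HSets θ) :
    P x := by
  by_contra hx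
  obtain ⟨y, hy, hPy⟩ := h.not.exists_mem (P := fun x => ¬ P x) ⟨x, hx⟩
  exact hPy (hP y hy)

/-- An element of `H(θ)` that is definable over `M` belongs to `M`. -/
theorem mem_of_unique {P : HSets θ → Prop}
    (h : DefinableOver M (fun v : Unit → HSets θ => P (v ()))) {x : HSets θ} (hx : P x)
    (huniq : ∀ y, P y → y = x) : x ∈ M := by
  obtain ⟨y, hy, hPy⟩ := h.exists_mem ⟨x, hx⟩
  exact huniq y hPy ▸ hy

end DefinableOver

end Definability

/-! ### Codes of ordinals, rationals and reals -/

section Codes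

theorem mem_codeSet {A : Type*} [Small.{0} A] {c : A → ZFSet.{0}} {s : Set A} {z : ZFSet.{0}} :
    z ∈ codeSet c s ↔ ∃ a ∈ s, c a = z := by
  rw [codeSet, ZFSet.mem_range]
  exact ⟨fun ⟨a, ha⟩ => ⟨a.1, a.2, ha⟩, fun ⟨a, ha, h⟩ => ⟨⟨a, ha⟩, h⟩⟩

theorem codeOrd_injective : Function.Injective codeOrd := fun _ _ h =>
  Subtype.ext (Ordinal.toZFSet_injective h)

theorem codeNat_injective : Function.Injective codeNat := fun m n h => by
  exact_mod_cast Ordinal.toZFSet_injective h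

theorem codeRat_injective : Function.Injective codeRat := fun p q h => by
  obtain ⟨h1, h2⟩ := ZFSet.pair_injective h
  obtain ⟨h2, h3⟩ := ZFSet.pair_injective h2
  have h1 := codeNat_injective h1
  have h2 := codeNat_injective h2
  have h3 := codeNat_injective h3
  exact Rat.ext (by omega) h3

theorem codeRat_mem_codeReal {q : ℚ} {x : ℝ} : codeRat q ∈ codeReal x ↔ (q : ℝ) < x := by
  rw [codeReal, mem_codeSet]
  constructor
  · rintro ⟨p, hp, h⟩
    exact codeRat_injective h ▸ hp
  · exact fun h => ⟨q, h, rfl⟩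

theorem codeReal_injective : Function.Injective codeReal := fun x y h => by
  have key : ∀ q : ℚ, (q : ℝ) < x ↔ (q : ℝ) < y := fun q => by
    rw [← codeRat_mem_codeReal, h, codeRat_mem_codeReal]
  refine le_antisymm (le_of_not_gt fun hlt => ?_) (le_of_not_gt fun hlt => ?_)
  · obtain ⟨q, h1, h2⟩ := exists_rat_btwn hlt
    exact lt_asymm h1 ((key q).1 h2)
  · obtain ⟨q, h1, h2⟩ := exists_rat_btwn hlt
    exact lt_asymm h1 ((key q).2 h2)

theorem mem_codeRealFinset {H : Finset ℝ} {z : ZFSet.{0}} :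
    z ∈ codeRealFinset H ↔ ∃ x ∈ H, codeReal x = z := by
  rw [codeRealFinset, mem_codeSet]
  rfl

theorem codeReal_mem_codeRealFinset {H : Finset ℝ} {x : ℝ} :
    codeReal x ∈ codeRealFinset H ↔ x ∈ H := by
  rw [mem_codeRealFinset]
  exact ⟨fun ⟨y, hy, h⟩ => codeReal_injective h ▸ hy, fun h => ⟨x, h, rfl⟩⟩

theorem mem_codeOrdFinset {F : Finset OmegaOne} {z : ZFSet.{0}} :
    z ∈ codeOrdFinset F ↔ ∃ γ ∈ F, codeOrd γ = z := by
  rw [codeOrdFinset, mem_codeSet]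
  rfl

theorem codeOrd_mem_codeOrdFinset {F : Finset OmegaOne} {γ : OmegaOne} :
    codeOrd γ ∈ codeOrdFinset F ↔ γ ∈ F := by
  rw [mem_codeOrdFinset]
  exact ⟨fun ⟨δ, hδ, h⟩ => codeOrd_injective h ▸ hδ, fun h => ⟨γ, h, rfl⟩⟩

theorem codeOrd_mem_codeOrd {γ δ : OmegaOne} : codeOrd γ ∈ codeOrd δ ↔ γ < δ :=
  Ordinal.toZFSet_mem_toZFSet_iff

theorem codeOrd_mem_omegaOne (γ : OmegaOne) : codeOrd γ ∈ (ω₁ : Ordinal.{0}).toZFSet :=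
  Ordinal.toZFSet_mem_toZFSet_iff.2 γ.2

theorem pair_mem_codeSequence {B : OmegaOne → Set (Finset OmegaOne)} {x y : ZFSet.{0}} :
    ZFSet.pair x y ∈ codeSequence B ↔
      ∃ γ, codeOrd γ = x ∧ codeSet codeOrdFinset (B γ) = y := by
  rw [codeSequence, ZFSet.mem_range]
  simp only [ZFSet.pair_inj]

theorem ZFSet.IsFunc.eq_of_pair_mem {X Y f x y z : ZFSet.{0}} (hf : ZFSet.IsFunc X Y f)
    (hy : ZFSet.pair x y ∈ f) (hz : ZFSet.pair x z ∈ f) : y = z :=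
  (hf.2 x (ZFSet.pair_mem_prod.1 (hf.1 hy)).1).unique hy hz

/-- Every real lies in a rational interval, and so does every finite set of reals; hence
`[ℝ]^{<ω}` is the union of `𝒲`. -/
theorem exists_mem_baseW (H : Finset ℝ) : ∃ W ∈ baseW, H ∈ W := by
  obtain ⟨a, ha⟩ := H.finite_toSet.bddBelow
  obtain ⟨b, hb⟩ := H.finite_toSet.bddAbove
  obtain ⟨p, hp⟩ := exists_rat_lt a
  obtain ⟨q, hq⟩ := exists_rat_gt b
  refine ⟨_, ⟨{(p, q)}, by simp, rfl⟩, fun x hx => ?_⟩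
  simp only [Finset.mem_singleton, iUnion_iUnion_eq_left, ratInterval]
  exact ⟨hp.trans_le (ha hx), (hb hx).trans_lt hq⟩

variable {θ : Cardinal.{0}} {M : setLanguage.ElementarySubstructure (HSets θ)}

theorem HSets.of_pair {x y : ZFSet.{0}} (h : ZFSet.pair x y ∈ HSets θ) :
    x ∈ HSets θ ∧ y ∈ HSets θ := by
  have h1 : ({x, y} : ZFSet.{0}) ∈ HSets θ := HSets.mem_of_mem h (by simp [ZFSet.pair])
  exact ⟨HSets.mem_of_mem h1 (by simp), HSets.mem_of_mem h1 (by simp)⟩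

theorem HSets.of_pair_mem {x y z : ZFSet.{0}} (hz : z ∈ HSets θ) (h : ZFSet.pair x y ∈ z) :
    x ∈ HSets θ ∧ y ∈ HSets θ :=
  HSets.of_pair (HSets.mem_of_mem hz h)

theorem mem_modelSets {x : HSets θ} : (x : ZFSet.{0}) ∈ modelSets M ↔ x ∈ M := by
  constructor
  · rintro ⟨y, hy, h⟩
    exact Subtype.ext h ▸ hy
  · exact fun h => ⟨x, h, rfl⟩

open DefinableOver in
theorem pair_mem_model {x y p : HSets θ} (hx : x ∈ M) (hy : y ∈ M)
    (hp : (p : ZFSet.{0}) = ZFSet.pair x y) : p ∈ M :=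
  mem_of_unique (P := fun p => (p : ZFSet.{0}) = ZFSet.pair x y)
    (eq_pair (.const hx) (.const hy) (.var _)) hp fun _ hz => Subtype.ext (hz.trans hp.symm)

open DefinableOver in
/-- Finite ordinals are definable, one by one. -/
theorem codeNat_mem_model (h : ∀ n, codeNat n ∈ HSets θ) (n : ℕ) :
    (⟨codeNat n, h n⟩ : HSets θ) ∈ M := by
  induction n with
  | zero =>
    refine mem_of_unique (P := fun x => ∀ z : HSets θ, ¬ (z : ZFSet.{0}) ∈ (x : ZFSet.{0}))
      (all (not (mem (.var _) (.var _)))) (fun z => by simp [codeNat]) fun y hy => ?_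
    refine Subtype.ext (?_ : (y : ZFSet.{0}) = codeNat 0)
    rw [codeNat, Nat.cast_zero, Ordinal.toZFSet_zero, ZFSet.eq_empty]
    exact fun z hz => hy ⟨z, HSets.mem_of_mem y.2 hz⟩ hz
  | succ n ih =>
    have hsucc : ∀ z, z ∈ codeNat (n + 1) ↔ z = codeNat n ∨ z ∈ codeNat n := fun z => by
      rw [codeNat, Nat.cast_succ, Ordinal.toZFSet_add_one, ZFSet.mem_insert_iff, codeNat]
    refine mem_of_unique (P := fun x =>
      (∀ z : HSets θ, (z : ZFSet.{0}) ∈ (x : ZFSet.{0}) →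
        z = ⟨codeNat n, h n⟩ ∨ (z : ZFSet.{0}) ∈ ((⟨codeNat n, h n⟩ : HSets θ) : ZFSet.{0})) ∧
      (∀ z : HSets θ,
        z = ⟨codeNat n, h n⟩ ∨ (z : ZFSet.{0}) ∈ ((⟨codeNat n, h n⟩ : HSets θ) : ZFSet.{0}) →
        (z : ZFSet.{0}) ∈ (x : ZFSet.{0})))
      (and (all (imp (mem (.var _) (.var _)) (or (eq (.var _) (.const ih))
        (mem (.var _) (.const ih)))))
        (all (imp (or (eq (.var _) (.const ih)) (mem (.var _) (.const ih)))
          (mem (.var _) (.var _))))) ⟨fun z hz => ?_, fun z hz => ?_⟩ fun y hy => ?_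
    · simpa [Subtype.ext_iff] using (hsucc _).1 hz
    · exact (hsucc _).2 (by simpa [Subtype.ext_iff] using hz)
    · refine Subtype.ext (ZFSet.ext fun z => ?_)
      rw [hsucc]
      constructor
      · intro hz
        simpa [Subtype.ext_iff] using hy.1 ⟨z, HSets.mem_of_mem y.2 hz⟩ hz
      · intro hz
        have hzN : z ∈ HSets θ := by
          rcases hz with rfl | hz
          · exact h n
          · exact HSets.mem_of_mem (h n) hz
        exact hy.2 ⟨z, hzN⟩ (by simpa [Subtype.ext_iff] using hz)

theorem codeRat_mem_model (h : ∀ n, codeNat n ∈ HSets θ) (hq : ∀ q, codeRat q ∈ HSets θ) (q : ℚ) :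
    (⟨codeRat q, hq q⟩ : HSets θ) ∈ M := by
  have h2 : ZFSet.pair (codeNat (-q.num).toNat) (codeNat q.den) ∈ HSets θ :=
    (HSets.of_pair (hq q)).2
  exact pair_mem_model (x := ⟨_, h _⟩) (y := ⟨_, h2⟩) (codeNat_mem_model h _)
    (pair_mem_model (x := ⟨_, h _⟩) (y := ⟨_, h _⟩) (codeNat_mem_model h _)
      (codeNat_mem_model h _) rfl) rfl

end Codes

/-! ### The generic point chosen by an elementary submodel -/

/-- The basic set `⋂ {U_γ : γ ∈ K} ∩ φ⁻¹(Q*)`, for any `Q ⊆ ℝ`. -/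
def basicNhd (U : OmegaOne → Set OmegaOne) (φ : OmegaOne → Finset ℝ) (K : Finset OmegaOne)
    (Q : Set ℝ) : Set OmegaOne :=
  {y | (∀ γ ∈ K, y ∈ U γ) ∧ (φ y : Set ℝ) ⊆ Q}

/-- The union of the half-open intervals `(p, q]`, `(p, q) ∈ s`. That `x ∈ (p, q]` is a quantifier
free statement about the Dedekind cut `x`: it contains `p` and does not contain `q`. -/
def ratCover (s : Finset (ℚ × ℚ)) : Set ℝ := ⋃ p ∈ s, Ioc (p.1 : ℝ) (p.2 : ℝ)

theorem mem_ratCover {s : Finset (ℚ × ℚ)} {x : ℝ} :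
    x ∈ ratCover s ↔
      ∃ p ∈ s, codeRat p.1 ∈ codeReal x ∧ codeRat p.2 ∉ codeReal x := by
  simp only [ratCover, mem_iUnion, exists_prop, mem_Ioc, codeRat_mem_codeReal, not_lt]

/-- Between a finite set of reals and an open set around it there is a finite union of rational
intervals, even with the right end points added. -/
theorem exists_ratIntervals (H : Finset ℝ) {Q : Set ℝ} (hQ : IsOpen Q) (hHQ : (H : Set ℝ) ⊆ Q) :
    ∃ s : Finset (ℚ × ℚ), (H : Set ℝ) ⊆ ⋃ p ∈ s, ratInterval p ∧ ratCover s ⊆ Q := by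
  classical
  have h : ∀ x : ℝ, ∃ p : ℚ × ℚ, x ∈ H → x ∈ ratInterval p ∧ Ioc (p.1 : ℝ) (p.2 : ℝ) ⊆ Q := by
    intro x
    by_cases hx : x ∈ H
    · obtain ⟨ε, hε, hball⟩ := Metric.isOpen_iff.1 hQ x (hHQ hx)
      rw [Real.ball_eq_Ioo] at hball
      obtain ⟨p, hp1, hp2⟩ := exists_rat_btwn (sub_lt_self x hε)
      obtain ⟨q, hq1, hq2⟩ := exists_rat_btwn (lt_add_of_pos_right x hε)
      exact ⟨(p, q), fun _ => ⟨⟨hp2, hq1⟩, fun z hz =>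
        hball ⟨hp1.trans hz.1, lt_of_le_of_lt hz.2 hq2⟩⟩⟩
    · exact ⟨(0, 0), fun h => absurd h hx⟩
  choose p hp using h
  refine ⟨H.image p, fun x hx => ?_, ?_⟩
  · exact mem_biUnion (Finset.mem_coe.2 (Finset.mem_image_of_mem p hx)) (hp x hx).1
  · refine iUnion₂_subset fun q hq => ?_
    obtain ⟨x, hx, rfl⟩ := Finset.mem_image.1 hq
    exact (hp x hx).2

theorem basicNhd_mono {U : OmegaOne → Set OmegaOne} {φ : OmegaOne → Finset ℝ}
    {K : Finset OmegaOne} {Q Q' : Set ℝ} (h : Q ⊆ Q') : basicNhd U φ K Q ⊆ basicNhd U φ K Q' :=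
  fun _ hy => ⟨hy.1, hy.2.trans h⟩

section Generic

variable {B : OmegaOne → Set (Finset OmegaOne)} {U : OmegaOne → Set OmegaOne}
  {φ : OmegaOne → Finset ℝ} {α : OmegaOne} {θ : Cardinal.{0}}
  {M : setLanguage.ElementarySubstructure (HSets θ)}

open DefinableOver in
/-- Let `M` witness that `α` belongs to the guessed points, with `A`, `f`, `v` in `M` extending
`B_α`, `φ ↾ α` and `{U_γ ∩ α}_{γ < α}`. Every `F* ∈ A \ M` is a finite set of ordinals `≥ α`, and
`H = ⋃ {f(x) : x ∈ F*}` and `D = {γ < α : F* ⊆ v(γ)}` are as required: whatever holds in `H(θ)` of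
`F*` and finitely many parameters from `M` holds of some member of `M ∩ A = B_α`, and whatever holds
of all members of `B_α` holds of `F*`. -/
theorem exists_generic_point (hB : IsDiamondSequenceOnFinsets B)
    (hpd : (B α).PairwiseDisjoint id) (hsub : ∀ F ∈ B α, (F : Set OmegaOne) ⊆ Iio α)
    (hMc : (modelSets M).Countable)
    (hM : WitnessesAt B (fun α γ => U γ ∩ Iic α) (fun _ => φ) α M)
    (hne : ∀ γ < α, (φ γ).Nonempty) (hdisj : (Iio α).PairwiseDisjoint φ) :
    ∃ (H : Finset ℝ) (D : Set OmegaOne), D ⊆ Iio α ∧ H.Nonempty ∧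
      (∀ γ < α, Disjoint (φ γ) H) ∧
      (∀ K : Finset OmegaOne, (K : Set OmegaOne) ⊆ D → ∀ Q : Set ℝ, IsOpen Q → (H : Set ℝ) ⊆ Q →
        ∃ F ∈ B α, (F : Set OmegaOne) ⊆ basicNhd U φ K Q) ∧
      ∀ β < α, (∀ F ∈ B β, (F : Set OmegaOne) ⊆ Iio β) →
        ∀ K : Finset OmegaOne, (K : Set OmegaOne) ⊆ Iio α → ∀ s : Finset (ℚ × ℚ),
        ∀ G : Finset OmegaOne, (G : Set OmegaOne) ⊆ Ioo β α →
        (∀ E : Finset OmegaOne, (E : Set OmegaOne) ⊆ Ioo β α →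
          ∃ F ∈ B β, (F : Set OmegaOne) ⊆ basicNhd U φ K (ratCover s) ∧
            ∀ γ ∈ F, (E : Set OmegaOne) ⊆ U γ) →
        ∃ F ∈ B β, (F : Set OmegaOne) ⊆ basicNhd U φ K (ratCover s) ∧
          (F : Set OmegaOne) ⊆ D ∧ ∀ γ ∈ F, (G : Set OmegaOne) ⊆ U γ := by
  classical
  obtain ⟨hM1, hM2, hM3, hM4, hM5, hM6⟩ := hM
  obtain ⟨W, hWM, hW⟩ := hM2
  obtain ⟨S, hSM, hS⟩ := hM3
  obtain ⟨_, ⟨f, hfM, rfl⟩, ⟨X, Y, hf⟩, hfφ⟩ := hM4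
  obtain ⟨_, ⟨A, hAM, rfl⟩, hAunc, hAB⟩ := hM5
  obtain ⟨_, ⟨v, hvM, rfl⟩, ⟨Z, hv⟩, hvU⟩ := hM6
  -- Codes of ordinals and rationals as elements of `H(θ)`.
  have hoN : ∀ γ, codeOrd γ ∈ HSets θ := fun γ => by
    obtain ⟨w, hw, -⟩ := hv.2 _ (codeOrd_mem_omegaOne γ)
    exact (HSets.of_pair_mem v.2 hw).1
  let o : OmegaOne → HSets θ := fun γ => ⟨codeOrd γ, hoN γ⟩
  have hoM : ∀ γ, o γ ∈ M ↔ γ < α := fun γ => by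
    rw [← mem_modelSets, ← codeOrd_mem_codeOrd]
    have h := Set.ext_iff.1 hM1 (codeOrd γ)
    simp only [mem_inter_iff, mem_ofPred_eq, codeOrd_mem_omegaOne, and_true] at h
    exact h
  have hrN : ∀ q, codeRat q ∈ HSets θ := fun q => by
    obtain ⟨x, hx⟩ := exists_rat_gt (q : ℝ)
    obtain ⟨V, hV, hxV⟩ := exists_mem_baseW {(x : ℝ)}
    have h1 : codeSet codeRealFinset V ∈ (W : ZFSet.{0}) := by
      rw [hW]; exact mem_codeSet.2 ⟨V, hV, rfl⟩
    have h2 : codeRealFinset {(x : ℝ)} ∈ codeSet codeRealFinset V := mem_codeSet.2 ⟨_, hxV, rfl⟩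
    have h3 : codeReal (x : ℝ) ∈ codeRealFinset {(x : ℝ)} :=
      codeReal_mem_codeRealFinset.2 (Finset.mem_singleton_self _)
    exact HSets.mem_of_mem (HSets.mem_of_mem (HSets.mem_of_mem (HSets.mem_of_mem W.2 h1) h2) h3)
      (codeRat_mem_codeReal.2 hx)
  have hnN : ∀ n, codeNat n ∈ HSets θ := fun n =>
    hoN ⟨(n : Ordinal), (Ordinal.natCast_lt_omega0 n).trans Ordinal.omega0_lt_omega_one⟩
  let r : ℚ → HSets θ := fun q => ⟨codeRat q, hrN q⟩
  have hrM : ∀ q, r q ∈ M := fun q => codeRat_mem_model hnN hrN q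
  -- The elements of `M ∩ A` are the codes of the members of `B_α`.
  have hABmem : ∀ E ∈ M, (E : ZFSet.{0}) ∈ (A : ZFSet.{0}) →
      ∃ F ∈ B α, codeOrdFinset F = (E : ZFSet.{0}) := fun E hE hEA => by
    have h : (E : ZFSet.{0}) ∈ modelSets M ∩ {x | x ∈ (A : ZFSet.{0})} :=
      ⟨mem_modelSets.2 hE, hEA⟩
    rw [hAB] at h
    exact h
  have hvx : ∀ {γ δ : OmegaOne} {w : ZFSet.{0}}, γ < α → δ < α →
      ZFSet.pair (codeOrd γ) w ∈ (v : ZFSet.{0}) → (codeOrd δ ∈ w ↔ δ ∈ U γ) := by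
    intro γ δ w hγ hδ hw
    obtain ⟨w', hw', h⟩ := hvU γ hγ
    rw [hv.eq_of_pair_mem hw hw', h δ hδ]
    exact and_iff_left hδ.le
  have hfx : ∀ {γ : OmegaOne} {h : ZFSet.{0}}, γ < α →
      ZFSet.pair (codeOrd γ) h ∈ (f : ZFSet.{0}) → h = codeRealFinset (φ γ) :=
    fun hγ hh => hf.eq_of_pair_mem hh (hfφ _ hγ)
  -- Members of `A` are finite sets of countable ordinals.
  have hA1 : ∀ E : HSets θ, (E : ZFSet.{0}) ∈ (A : ZFSet.{0}) →
      ∃ b c : HSets θ, ZFSet.pair b c ∈ (S : ZFSet.{0}) ∧ (E : ZFSet.{0}) ∈ (c : ZFSet.{0}) := by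
    refine forall_of_mem (M := M) (imp (mem (.var _) (.const hAM)) (ex (ex (and
      (pair_mem (.var _) (.var _) (.const hSM)) (mem (.var _) (.var _)))))) fun E hE hEA => ?_
    obtain ⟨F, -, hF⟩ := hABmem E hE hEA
    obtain ⟨β, hβ⟩ := hB.exists_mem F
    have h1 : ZFSet.pair (codeOrd β) (codeSet codeOrdFinset (B β)) ∈ (S : ZFSet.{0}) := by
      rw [hS]; exact pair_mem_codeSequence.2 ⟨β, rfl, rfl⟩
    exact ⟨o β, ⟨_, (HSets.of_pair_mem S.2 h1).2⟩, h1, mem_codeSet.2 ⟨F, hβ, hF⟩⟩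
  have hA1' : ∀ E : HSets θ, (E : ZFSet.{0}) ∈ (A : ZFSet.{0}) →
      ∃ F, codeOrdFinset F = (E : ZFSet.{0}) := fun E hE => by
    obtain ⟨b, c, hbc, hEc⟩ := hA1 E hE
    rw [hS] at hbc
    obtain ⟨β, -, hc⟩ := pair_mem_codeSequence.1 hbc
    rw [← hc] at hEc
    obtain ⟨F, -, hF⟩ := mem_codeSet.1 hEc
    exact ⟨F, hF⟩
  -- On members of `A` the function `f` takes nonempty finite sets of reals as values.
  have hA2 : ∀ E : HSets θ, (E : ZFSet.{0}) ∈ (A : ZFSet.{0}) →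
      ∀ x : HSets θ, (x : ZFSet.{0}) ∈ (E : ZFSet.{0}) → ∃ w h y : HSets θ,
        (w : ZFSet.{0}) ∈ (W : ZFSet.{0}) ∧ (h : ZFSet.{0}) ∈ (w : ZFSet.{0}) ∧
        (y : ZFSet.{0}) ∈ (h : ZFSet.{0}) ∧ ZFSet.pair x h ∈ (f : ZFSet.{0}) := by
    refine forall_of_mem (M := M) (imp (mem (.var _) (.const hAM)) (all (imp
      (mem (.var _) (.var _)) (ex (ex (ex (and (mem (.var _) (.const hWM)) (and
        (mem (.var _) (.var _)) (and (mem (.var _) (.var _))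
          (pair_mem (.var _) (.var _) (.const hfM))))))))))) fun E hE hEA x hx => ?_
    obtain ⟨F, hFB, hF⟩ := hABmem E hE hEA
    rw [← hF] at hx
    obtain ⟨γ, hγ, hγx⟩ := mem_codeOrdFinset.1 hx
    have hγα : γ < α := hsub F hFB hγ
    obtain ⟨y, hy⟩ := hne γ hγα
    obtain ⟨V, hV, hφV⟩ := exists_mem_baseW (φ γ)
    have h1 : codeSet codeRealFinset V ∈ (W : ZFSet.{0}) := by
      rw [hW]; exact mem_codeSet.2 ⟨V, hV, rfl⟩
    have h2 : codeRealFinset (φ γ) ∈ codeSet codeRealFinset V := mem_codeSet.2 ⟨_, hφV, rfl⟩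
    have h3 : codeReal y ∈ codeRealFinset (φ γ) := codeReal_mem_codeRealFinset.2 hy
    have h1N := HSets.mem_of_mem W.2 h1
    have h2N := HSets.mem_of_mem h1N h2
    exact ⟨⟨_, h1N⟩, ⟨_, h2N⟩, ⟨_, HSets.mem_of_mem h2N h3⟩, h1, h2, h3, hγx ▸ hfφ γ hγα⟩
  have hA2' : ∀ E : HSets θ, (E : ZFSet.{0}) ∈ (A : ZFSet.{0}) →
      ∀ γ, codeOrd γ ∈ (E : ZFSet.{0}) → ∃ H : Finset ℝ, H.Nonempty ∧
        ZFSet.pair (codeOrd γ) (codeRealFinset H) ∈ (f : ZFSet.{0}) := fun E hE γ hγ => by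
    obtain ⟨w, h, y, hw, hhw, hy, hfh⟩ := hA2 E hE (o γ) hγ
    rw [hW] at hw
    obtain ⟨V, -, hV⟩ := mem_codeSet.1 hw
    rw [← hV] at hhw
    obtain ⟨H, -, hH⟩ := mem_codeSet.1 hhw
    rw [← hH] at hy hfh
    obtain ⟨z, hz, -⟩ := mem_codeRealFinset.1 hy
    exact ⟨H, ⟨z, hz⟩, hfh⟩
  -- Distinct members of `A` are disjoint.
  have hA3 : ∀ E E' : HSets θ, (E : ZFSet.{0}) ∈ (A : ZFSet.{0}) →
      (E' : ZFSet.{0}) ∈ (A : ZFSet.{0}) → ∀ x : HSets θ, (x : ZFSet.{0}) ∈ (E : ZFSet.{0}) →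
      (x : ZFSet.{0}) ∈ (E' : ZFSet.{0}) → E = E' := by
    refine forall_of_mem (M := M) (all (imp (mem (.var _) (.const hAM)) (imp
      (mem (.var _) (.const hAM)) (all (imp (mem (.var _) (.var _)) (imp (mem (.var _) (.var _))
        (eq (.var _) (.var _)))))))) fun E hE => ?_
    refine forall_of_mem (M := M) (imp (mem (.const hE) (.const hAM)) (imp
      (mem (.var _) (.const hAM)) (all (imp (mem (.var _) (.const hE)) (imp (mem (.var _) (.var _))
        (eq (.const hE) (.var _))))))) fun E' hE' hEA hEA' x hx hx' => ?_
    obtain ⟨F, hFB, hF⟩ := hABmem E hE hEA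
    obtain ⟨F', hFB', hF'⟩ := hABmem E' hE' hEA'
    rw [← hF] at hx
    rw [← hF'] at hx'
    obtain ⟨γ, hγ, hγx⟩ := mem_codeOrdFinset.1 hx
    obtain ⟨γ', hγ', hγx'⟩ := mem_codeOrdFinset.1 hx'
    have hγγ : γ = γ' := codeOrd_injective (hγx.trans hγx'.symm)
    have hFF : F = F' := by
      by_contra hcon
      exact Finset.disjoint_left.1 (hpd hFB hFB' hcon) hγ (hγγ ▸ hγ')
    exact Subtype.ext (by rw [← hF, ← hF', hFF])
  -- Values of `f` on members of `A` are disjoint from `φ γ`, for `γ < α`, except at `γ` itself.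
  have hA4 : ∀ γ < α, ∀ E : HSets θ, (E : ZFSet.{0}) ∈ (A : ZFSet.{0}) →
      ∀ x h h' y : HSets θ, (x : ZFSet.{0}) ∈ (E : ZFSet.{0}) →
      ZFSet.pair (o γ) h ∈ (f : ZFSet.{0}) → ZFSet.pair x h' ∈ (f : ZFSet.{0}) →
      (y : ZFSet.{0}) ∈ (h : ZFSet.{0}) → (y : ZFSet.{0}) ∈ (h' : ZFSet.{0}) → x = o γ := by
    intro γ hγ
    have hγM := (hoM γ).2 hγ
    refine forall_of_mem (M := M) (imp (mem (.var _) (.const hAM)) (all (all (all (all (imp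
      (mem (.var _) (.var _)) (imp (pair_mem (.const hγM) (.var _) (.const hfM)) (imp
        (pair_mem (.var _) (.var _) (.const hfM)) (imp (mem (.var _) (.var _)) (imp
          (mem (.var _) (.var _)) (eq (.var _) (.const hγM)))))))))))) ?_
    intro E hE hEA x h h' y hx hh hh' hy hy'
    obtain ⟨F, hFB, hF⟩ := hABmem E hE hEA
    rw [← hF] at hx
    obtain ⟨δ, hδ, hδx⟩ := mem_codeOrdFinset.1 hx
    rw [← hδx] at hh'
    rw [hfx hγ hh] at hy
    rw [hfx (hsub F hFB hδ) hh'] at hy'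
    obtain ⟨a, ha, hay⟩ := mem_codeRealFinset.1 hy
    obtain ⟨b, hb, hby⟩ := mem_codeRealFinset.1 hy'
    have hab : a = b := codeReal_injective (hay.trans hby.symm)
    have hδγ : δ = γ := by
      by_contra hcon
      exact Finset.disjoint_left.1 (hdisj (hsub F hFB hδ) hγ hcon) hb (hab ▸ ha)
    exact Subtype.ext (hδx.symm.trans (by rw [hδγ]))
  -- The generic member `F*` of `A`.
  obtain ⟨E', hE'A, hE'M⟩ : ∃ E, E ∈ (A : ZFSet.{0}) ∧ E ∉ modelSets M := by
    by_contra! hcon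
    exact hAunc (hMc.mono hcon)
  obtain ⟨E, rfl⟩ : ∃ E : HSets θ, (E : ZFSet.{0}) = E' := ⟨⟨E', HSets.mem_of_mem A.2 hE'A⟩, rfl⟩
  rw [mem_modelSets] at hE'M
  obtain ⟨F, hF⟩ := hA1' E hE'A
  have hmemF : ∀ {γ}, codeOrd γ ∈ (E : ZFSet.{0}) ↔ γ ∈ F := by
    intro γ
    rw [← hF, codeOrd_mem_codeOrdFinset]
  have hFα : ∀ γ ∈ F, α ≤ γ := fun γ hγ => by
    by_contra! hlt
    have hγM := (hoM γ).2 hlt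
    obtain ⟨E₁, hE₁, hE₁A, hγE₁⟩ := exists_mem (M := M) (P := fun E =>
      (E : ZFSet.{0}) ∈ (A : ZFSet.{0}) ∧ (o γ : ZFSet.{0}) ∈ (E : ZFSet.{0}))
      (and (mem (.var _) (.const hAM)) (mem (.const hγM) (.var _))) ⟨E, hE'A, hmemF.2 hγ⟩
    exact hE'M (hA3 E₁ E hE₁A hE'A (o γ) hγE₁ (hmemF.2 hγ) ▸ hE₁)
  have hFne : F.Nonempty := by
    rw [Finset.nonempty_iff_ne_empty]
    rintro rfl
    obtain ⟨E₁, hE₁, hE₁e⟩ := exists_mem (M := M) (P := fun E =>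
      ∀ x : HSets θ, ¬ (x : ZFSet.{0}) ∈ (E : ZFSet.{0})) (all (not (mem (.var _) (.var _))))
      ⟨E, fun x hx => by rw [← hF] at hx; obtain ⟨γ, hγ, -⟩ := mem_codeOrdFinset.1 hx; simp at hγ⟩
    refine hE'M ((Subtype.ext ?_ : E₁ = E) ▸ hE₁)
    ext z
    constructor
    · exact fun hz => absurd hz (hE₁e ⟨z, HSets.mem_of_mem E₁.2 hz⟩)
    · intro hz
      rw [← hF] at hz
      obtain ⟨γ, hγ, -⟩ := mem_codeOrdFinset.1 hz
      simp at hγ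
  have hg : ∀ γ, ∃ H : Finset ℝ, γ ∈ F → H.Nonempty ∧
      ZFSet.pair (codeOrd γ) (codeRealFinset H) ∈ (f : ZFSet.{0}) := fun γ => by
    by_cases hγ : γ ∈ F
    · obtain ⟨H, h⟩ := hA2' E hE'A γ (hmemF.2 hγ)
      exact ⟨H, fun _ => h⟩
    · exact ⟨∅, fun h => absurd h hγ⟩
  choose g hg using hg
  have hvw : ∀ γ, ∃ w : HSets θ, ZFSet.pair (codeOrd γ) w ∈ (v : ZFSet.{0}) := fun γ => by
    obtain ⟨w, hw, -⟩ := hv.2 _ (codeOrd_mem_omegaOne γ)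
    exact ⟨⟨w, (HSets.of_pair_mem v.2 hw).2⟩, hw⟩
  refine ⟨F.biUnion g, {γ | γ < α ∧ ∃ w : HSets θ, ZFSet.pair (codeOrd γ) w ∈ (v : ZFSet.{0}) ∧
    ∀ δ ∈ F, codeOrd δ ∈ (w : ZFSet.{0})}, fun γ hγ => hγ.1, ?_, ?_, ?_, ?_⟩
  · obtain ⟨γ, hγ⟩ := hFne
    obtain ⟨y, hy⟩ := (hg γ hγ).1
    exact ⟨y, Finset.mem_biUnion.2 ⟨γ, hγ, hy⟩⟩
  · intro γ hγ
    rw [Finset.disjoint_left]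
    intro y hy hy'
    obtain ⟨δ, hδ, hyδ⟩ := Finset.mem_biUnion.1 hy'
    have h1 := hfφ γ hγ
    have h2 := (hg δ hδ).2
    have h1N := (HSets.of_pair_mem f.2 h1).2
    have h2N := (HSets.of_pair_mem f.2 h2).2
    have hyc := codeReal_mem_codeRealFinset.2 hy
    have := hA4 γ hγ E hE'A (o δ) ⟨_, h1N⟩ ⟨_, h2N⟩ ⟨_, HSets.mem_of_mem h1N hyc⟩ (hmemF.2 hδ)
      h1 h2 hyc (codeReal_mem_codeRealFinset.2 hyδ)
    have hδγ : δ = γ := codeOrd_injective (congrArg Subtype.val this)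
    exact absurd hγ (not_lt.2 (hδγ ▸ hFα δ hδ))
  · intro K hK Q hQ hHQ
    obtain ⟨s, hs1, hs2⟩ := exists_ratIntervals _ hQ hHQ
    have hKM : ∀ γ ∈ K, o γ ∈ M := fun γ hγ => (hoM γ).2 (hK hγ).1
    obtain ⟨E₁, hE₁, hE₁A, hE₁P⟩ := exists_mem (M := M) (P := fun E =>
      (E : ZFSet.{0}) ∈ (A : ZFSet.{0}) ∧ ∀ x : HSets θ, (x : ZFSet.{0}) ∈ (E : ZFSet.{0}) →
        (∀ γ ∈ K, ∃ w : HSets θ, ZFSet.pair (o γ) w ∈ (v : ZFSet.{0}) ∧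
          (x : ZFSet.{0}) ∈ (w : ZFSet.{0})) ∧
        ∃ h : HSets θ, ZFSet.pair x h ∈ (f : ZFSet.{0}) ∧ ∀ y : HSets θ,
          (y : ZFSet.{0}) ∈ (h : ZFSet.{0}) → ∃ p ∈ s,
            (r p.1 : ZFSet.{0}) ∈ (y : ZFSet.{0}) ∧ ¬ (r p.2 : ZFSet.{0}) ∈ (y : ZFSet.{0}))
      (and (mem (.var _) (.const hAM)) (all (imp (mem (.var _) (.var _)) (and
        (ball_finset K fun γ hγ => ex (and (pair_mem (.const (hKM γ hγ)) (.var _) (.const hvM))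
          (mem (.var _) (.var _))))
        (ex (and (pair_mem (.var _) (.var _) (.const hfM)) (all (imp (mem (.var _) (.var _))
          (bex_finset s fun p _ => and (mem (.const (hrM _)) (.var _))
            (not (mem (.const (hrM _)) (.var _))))))))))))
      ⟨E, hE'A, fun x hx => by
        obtain ⟨x, hxN⟩ := x
        simp only at hx
        rw [← hF] at hx
        obtain ⟨δ, hδ, rfl⟩ := mem_codeOrdFinset.1 hx
        refine ⟨fun γ hγ => ?_, ?_⟩
        · obtain ⟨-, w, hw, hFw⟩ := hK hγ
          exact ⟨w, hw, hFw δ hδ⟩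
        · refine ⟨⟨_, (HSets.of_pair_mem f.2 (hg δ hδ).2).2⟩, (hg δ hδ).2, fun y hy => ?_⟩
          obtain ⟨z, hz, hzy⟩ := mem_codeRealFinset.1 hy
          have hzs := hs1 (Finset.mem_coe.2 (Finset.mem_biUnion.2 ⟨δ, hδ, hz⟩))
          rw [← hzy]
          refine mem_ratCover.1 ?_
          simp only [mem_iUnion, exists_prop, ratCover] at hzs ⊢
          obtain ⟨p, hp, hzp⟩ := hzs
          exact ⟨p, hp, Ioo_subset_Ioc_self hzp⟩⟩
    obtain ⟨F₁, hF₁B, hF₁⟩ := hABmem E₁ hE₁ hE₁A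
    refine ⟨F₁, hF₁B, fun δ hδ => ?_⟩
    have hδα : δ < α := hsub F₁ hF₁B hδ
    obtain ⟨h1, h, hh, h2⟩ := hE₁P (o δ) (by rw [← hF₁]; exact codeOrd_mem_codeOrdFinset.2 hδ)
    refine ⟨fun γ hγ => ?_, fun z hz => hs2 (mem_ratCover.2 ?_)⟩
    · obtain ⟨w, hw, hδw⟩ := h1 γ hγ
      exact (hvx (hK hγ).1 hδα hw).1 hδw
    · have hzh : codeReal z ∈ (h : ZFSet.{0}) := by
        rw [hfx hδα hh]; exact codeReal_mem_codeRealFinset.2 hz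
      exact h2 ⟨codeReal z, HSets.mem_of_mem h.2 hzh⟩ hzh
  · intro β hβ hBβ K hK s G hG hcov
    have hβM := (hoM β).2 hβ
    have hKM : ∀ γ ∈ K, o γ ∈ M := fun γ hγ => (hoM γ).2 (hK hγ)
    have hGM : ∀ γ ∈ G, o γ ∈ M := fun γ hγ => (hoM γ).2 (hG hγ).2
    have key : ∀ E : HSets θ, (E : ZFSet.{0}) ∈ (A : ZFSet.{0}) →
        (∀ x : HSets θ, (x : ZFSet.{0}) ∈ (E : ZFSet.{0}) →
          (o β : ZFSet.{0}) ∈ (x : ZFSet.{0})) →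
        ∃ b F : HSets θ, ZFSet.pair (o β) b ∈ (S : ZFSet.{0}) ∧
          (F : ZFSet.{0}) ∈ (b : ZFSet.{0}) ∧
          ∀ d : HSets θ, (d : ZFSet.{0}) ∈ (F : ZFSet.{0}) →
            ((∀ γ ∈ K, ∃ w : HSets θ, ZFSet.pair (o γ) w ∈ (v : ZFSet.{0}) ∧
              (d : ZFSet.{0}) ∈ (w : ZFSet.{0})) ∧
            ∃ h : HSets θ, ZFSet.pair d h ∈ (f : ZFSet.{0}) ∧ ∀ y : HSets θ,
              (y : ZFSet.{0}) ∈ (h : ZFSet.{0}) → ∃ p ∈ s, (r p.1 : ZFSet.{0}) ∈ (y : ZFSet.{0}) ∧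
                ¬ (r p.2 : ZFSet.{0}) ∈ (y : ZFSet.{0})) ∧
            ∃ w : HSets θ, ZFSet.pair d w ∈ (v : ZFSet.{0}) ∧
              (∀ γ ∈ G, (o γ : ZFSet.{0}) ∈ (w : ZFSet.{0})) ∧
              ∀ x : HSets θ, (x : ZFSet.{0}) ∈ (E : ZFSet.{0}) →
                (x : ZFSet.{0}) ∈ (w : ZFSet.{0}) := by
      refine forall_of_mem (M := M) (imp (mem (.var _) (.const hAM)) (imp
        (all (imp (mem (.var _) (.var _)) (mem (.const hβM) (.var _))))
        (ex (ex (and (pair_mem (.const hβM) (.var _) (.const hSM)) (and (mem (.var _) (.var _))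
          (all (imp (mem (.var _) (.var _)) (and (and
            (ball_finset K fun γ hγ => ex (and (pair_mem (.const (hKM γ hγ)) (.var _) (.const hvM))
              (mem (.var _) (.var _))))
            (ex (and (pair_mem (.var _) (.var _) (.const hfM)) (all (imp (mem (.var _) (.var _))
              (bex_finset s fun p _ => and (mem (.const (hrM _)) (.var _))
                (not (mem (.const (hrM _)) (.var _)))))))))
            (ex (and (pair_mem (.var _) (.var _) (.const hvM)) (and
              (ball_finset G fun γ hγ => mem (.const (hGM γ hγ)) (.var _))
              (all (imp (mem (.var _) (.var _)) (mem (.var _) (.var _))))))))))))))))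
        fun E₁ hE₁ hE₁A hE₁β => ?_
      obtain ⟨F₁, hF₁B, hF₁⟩ := hABmem E₁ hE₁ hE₁A
      have hF₁β : ∀ γ ∈ F₁, β < γ := fun γ hγ => codeOrd_mem_codeOrd.1
        (hE₁β (o γ) (by rw [← hF₁]; exact codeOrd_mem_codeOrdFinset.2 hγ))
      obtain ⟨F₂, hF₂B, hF₂N, hF₂⟩ := hcov (F₁ ∪ G) (by
        rw [Finset.coe_union]
        exact union_subset (fun γ hγ => ⟨hF₁β γ hγ, hsub F₁ hF₁B hγ⟩) hG)
      have h1 : ZFSet.pair (codeOrd β) (codeSet codeOrdFinset (B β)) ∈ (S : ZFSet.{0}) := by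
        rw [hS]; exact pair_mem_codeSequence.2 ⟨β, rfl, rfl⟩
      have h1N := (HSets.of_pair_mem S.2 h1).2
      have h2 : codeOrdFinset F₂ ∈ codeSet codeOrdFinset (B β) := mem_codeSet.2 ⟨F₂, hF₂B, rfl⟩
      refine ⟨⟨_, h1N⟩, ⟨_, HSets.mem_of_mem h1N h2⟩, h1, h2, fun d hd => ?_⟩
      obtain ⟨d, hdN⟩ := d
      simp only at hd
      obtain ⟨δ, hδ, rfl⟩ := mem_codeOrdFinset.1 hd
      have hδα : δ < α := (mem_Iio.1 (hBβ F₂ hF₂B hδ)).trans hβ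
      refine ⟨⟨fun γ hγ => ?_, ?_⟩, ?_⟩
      · obtain ⟨w, hw⟩ := hvw γ
        exact ⟨w, hw, (hvx (hK hγ) hδα hw).2 ((hF₂N hδ).1 γ hγ)⟩
      · refine ⟨⟨_, (HSets.of_pair_mem f.2 (hfφ δ hδα)).2⟩, hfφ δ hδα, fun y hy => ?_⟩
        obtain ⟨z, hz, hzy⟩ := mem_codeRealFinset.1 hy
        rw [← hzy]
        exact mem_ratCover.1 ((hF₂N hδ).2 hz)
      · obtain ⟨w, hw⟩ := hvw δ
        refine ⟨w, hw, fun γ hγ => ?_, fun x hx => ?_⟩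
        · exact (hvx hδα (hG hγ).2 hw).2 (hF₂ δ hδ (by simp [Finset.mem_coe.1 hγ]))
        · rw [← hF₁] at hx
          obtain ⟨γ, hγ, hγx⟩ := mem_codeOrdFinset.1 hx
          rw [← hγx]
          exact (hvx hδα (hsub F₁ hF₁B hγ) hw).2 (hF₂ δ hδ (by simp [hγ]))
    obtain ⟨b, F₁, hb, hF₁b, hF₁⟩ := key E hE'A fun x hx => by
      rw [← hF] at hx
      obtain ⟨γ, hγ, hγx⟩ := mem_codeOrdFinset.1 hx
      rw [← hγx]
      exact codeOrd_mem_codeOrd.2 (hβ.trans_le (hFα γ hγ))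
    rw [hS] at hb
    obtain ⟨β', hβ', hbB⟩ := pair_mem_codeSequence.1 hb
    rw [codeOrd_injective hβ'] at hbB
    rw [← hbB] at hF₁b
    obtain ⟨F₂, hF₂B, hF₂⟩ := mem_codeSet.1 hF₁b
    rw [← hF₂] at hF₁
    have hlt : ∀ δ ∈ F₂, δ < α := fun δ hδ => (mem_Iio.1 (hBβ F₂ hF₂B hδ)).trans hβ
    refine ⟨F₂, hF₂B, fun δ hδ => ?_, fun δ hδ => ?_, fun δ hδ => ?_⟩
    · obtain ⟨⟨h1, h, hh, h2⟩, -⟩ := hF₁ (o δ) (codeOrd_mem_codeOrdFinset.2 hδ)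
      refine ⟨fun γ hγ => ?_, fun z hz => mem_ratCover.2 ?_⟩
      · obtain ⟨w, hw, hδw⟩ := h1 γ hγ
        exact (hvx (hK hγ) (hlt δ hδ) hw).1 hδw
      · have hzh : codeReal z ∈ (h : ZFSet.{0}) := by
          rw [hfx (hlt δ hδ) hh]; exact codeReal_mem_codeRealFinset.2 hz
        exact h2 ⟨codeReal z, HSets.mem_of_mem h.2 hzh⟩ hzh
    · obtain ⟨-, w, hw, -, h⟩ := hF₁ (o δ) (codeOrd_mem_codeOrdFinset.2 hδ)
      exact ⟨hlt δ hδ, w, hw, fun γ hγ => h (o γ) (hmemF.2 hγ)⟩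
    · obtain ⟨-, w, hw, h, -⟩ := hF₁ (o δ) (codeOrd_mem_codeOrdFinset.2 hδ)
      exact fun γ hγ => (hvx (hlt δ hδ) (hG hγ).2 hw).1 (h γ hγ)

end Generic

/-! ### The recursion -/

/-- Transfinite recursion with choices: if `P α d` depends only on `d ↾ (α + 1)` and a function
that satisfies `P` below `α` can be altered at `α` so as to satisfy it at `α`, then some function
satisfies `P` everywhere. -/
theorem exists_forall_of_extend {ι δ : Type*} [LinearOrder ι] [WellFoundedLT ι] [Inhabited δ]
    (P : ι → (ι → δ) → Prop)
    (hlocal : ∀ α d d', (∀ β ≤ α, d β = d' β) → P α d → P α d')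
    (hext : ∀ α d, (∀ β < α, P β d) → ∃ e, P α (Function.update d α e)) :
    ∃ d, ∀ α, P α d := by
  classical
  let ext : ∀ α : ι, (∀ β, β < α → δ) → ι → δ := fun α rec β =>
    if h : β < α then rec β h else default
  let step : ∀ α : ι, (∀ β, β < α → δ) → δ := fun α rec =>
    if h : ∃ e, P α (Function.update (ext α rec) α e) then h.choose else default
  let d : ι → δ := (wellFounded_lt (α := ι)).fix step
  have hd : ∀ α, d α = step α fun β _ => d β := fun α => WellFounded.fix_eq _ _ _
  refine ⟨d, fun α => ?_⟩
  induction α using WellFoundedLT.induction with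
  | ind α ih =>
    have hagree : ∀ β < α, ext α (fun β _ => d β) β = d β := fun β hβ => dif_pos hβ
    have h := hext α (ext α fun β _ => d β) fun β hβ =>
      hlocal β d _ (fun γ hγ => (hagree γ (hγ.trans_lt hβ)).symm) (ih β hβ)
    have hα : d α = h.choose := (hd α).trans (dif_pos h)
    refine hlocal α _ _ (fun β hβ => ?_) h.choose_spec
    rcases hβ.lt_or_eq with hβ | rfl
    · rw [Function.update_of_ne hβ.ne, hagree β hβ]
    · rw [Function.update_self, hα]

section Construction

variable (C : OmegaOne → Set OmegaOne) (B : OmegaOne → Set (Finset OmegaOne))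
  (d d' : OmegaOne → Finset ℝ × Set OmegaOne)

/-- The whole construction is coded by `d`, where `(d y).1` is the set `φ(y)` and `(d y).2` consists
of the `γ < y` with `y ∈ U_γ`. This is the set `U_γ`, which contains all `y ≤ γ`. -/
def subbaseSet (γ : OmegaOne) : Set OmegaOne := {y | y ≤ γ ∨ γ ∈ (d y).2}

/-- The basic sets of the space coded by `d`. -/
def basicSet (K : Finset OmegaOne) (Q : Set ℝ) : Set OmegaOne :=
  basicNhd (subbaseSet d) (fun y => (d y).1) K Q

/-- `α` is a guessed point of the space coded by `d`, a property of `d ↾ α`. -/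
def IsGuessed (α : OmegaOne) : Prop :=
  α ∈ guessedPoints B (fun α γ => subbaseSet d γ ∩ Iic α) (fun _ y => (d y).1) α

/-- In the space coded by `d ↾ α`, each point `x` has a neighbourhood that meets `C_α` in at most
`x`. -/
def SeparatesBelow (α : OmegaOne) : Prop :=
  ∀ x < α, ∃ (K : Finset OmegaOne) (Q : Set ℝ), IsOpen Q ∧ x ∈ basicSet d K Q ∧
    ∀ y < α, y ∈ basicSet d K Q → y ∈ C α → y = x

/-- What the recursion has to achieve at `α`, in terms of basic sets. -/
structure IsCorrectAt (α : OmegaOne) : Prop where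
  nonempty : (d α).1.Nonempty
  disjoint : ∀ γ < α, Disjoint (d γ).1 (d α).1
  notMem : SeparatesBelow C d α → ∀ γ ∈ C α, α ∉ subbaseSet d γ
  piNetwork : IsGuessed B d α → ∀ (K : Finset OmegaOne) (Q : Set ℝ), IsOpen Q →
    α ∈ basicSet d K Q → ∃ F ∈ B α, (F : Set OmegaOne) ⊆ basicSet d K Q
  omegaCover : ∀ β < α, IsGuessed B d β → ∀ (K : Finset OmegaOne) (Q : Set ℝ), IsOpen Q →
    β ∈ basicSet d K Q → ∀ G : Finset OmegaOne, (G : Set OmegaOne) ⊆ Ioc β α →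
    ∃ F ∈ B β, (F : Set OmegaOne) ⊆ basicSet d K Q ∧ ∀ γ ∈ F, (G : Set OmegaOne) ⊆ subbaseSet d γ

variable {C B d d'} {α : OmegaOne}

theorem mem_subbaseSet_congr {y γ : OmegaOne} (h : d y = d' y) :
    y ∈ subbaseSet d γ ↔ y ∈ subbaseSet d' γ := by
  simp only [subbaseSet, mem_ofPred_eq, h]

theorem mem_basicSet_congr {y : OmegaOne} {K : Finset OmegaOne} {Q : Set ℝ} (h : d y = d' y) :
    y ∈ basicSet d K Q ↔ y ∈ basicSet d' K Q := by
  simp only [basicSet, basicNhd, mem_ofPred_eq, h, mem_subbaseSet_congr h]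

theorem basicSet_inter {y : OmegaOne} {K K' : Finset OmegaOne} {Q Q' : Set ℝ} :
    y ∈ basicSet d (K ∪ K') (Q ∩ Q') ↔ y ∈ basicSet d K Q ∧ y ∈ basicSet d K' Q' := by
  simp only [basicSet, basicNhd, mem_ofPred_eq, Finset.mem_union, subset_inter_iff]
  constructor
  · exact fun h => ⟨⟨fun γ hγ => h.1 γ (Or.inl hγ), h.2.1⟩, fun γ hγ => h.1 γ (Or.inr hγ), h.2.2⟩
  · exact fun h => ⟨fun γ hγ => hγ.elim (h.1.1 γ) (h.2.1 γ), h.1.2, h.2.2⟩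

/-- The points of `K` above `y` impose no condition on `y`. -/
theorem mem_basicSet_filter {y : OmegaOne} {K : Finset OmegaOne} {Q : Set ℝ} (hy : y ≤ α) :
    y ∈ basicSet d (K.filter (· < α)) Q ↔ y ∈ basicSet d K Q := by
  simp only [basicSet, basicNhd, mem_ofPred_eq, Finset.mem_filter]
  refine and_congr_left fun _ => ⟨fun h γ hγ => ?_, fun h γ hγ => h γ hγ.1⟩
  rcases lt_or_ge γ α with hlt | hge
  · exact h γ ⟨hγ, hlt⟩
  · exact Or.inl (hy.trans hge)

theorem IsGuessed.subset_Iio (h : IsGuessed B d α) : ∀ F ∈ B α, (F : Set OmegaOne) ⊆ Iio α :=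
  h.2.2.1

theorem IsGuessed.congr (h : ∀ β < α, d β = d' β) (hα : IsGuessed B d α) : IsGuessed B d' α := by
  obtain ⟨h1, h2, h3, θ, M, hMc, hM⟩ := hα
  refine ⟨h1, h2, h3, θ, M, hMc, ⟨hM.inter_omegaOne, hM.baseW_mem, hM.sequence_mem, ?_,
    hM.exists_uncountable, ?_⟩⟩
  · obtain ⟨f, hf, hfun, hfφ⟩ := hM.exists_function
    refine ⟨f, hf, hfun, fun γ hγ => ?_⟩
    rw [← h γ hγ]
    exact hfφ γ hγ
  · obtain ⟨v, hv, hfun, hvU⟩ := hM.exists_sequence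
    refine ⟨v, hv, hfun, fun γ hγ => ?_⟩
    obtain ⟨w, hw, hwU⟩ := hvU γ hγ
    refine ⟨w, hw, fun δ hδ => (hwU δ hδ).trans ?_⟩
    exact and_congr_left fun _ => mem_subbaseSet_congr (h δ hδ)

theorem SeparatesBelow.congr (h : ∀ β < α, d β = d' β) (hα : SeparatesBelow C d α) :
    SeparatesBelow C d' α := fun x hx => by
  obtain ⟨K, Q, hQ, hxN, hN⟩ := hα x hx
  exact ⟨K, Q, hQ, (mem_basicSet_congr (h x hx)).1 hxN, fun y hy hyN =>
    hN y hy ((mem_basicSet_congr (h y hy)).2 hyN)⟩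

theorem IsCorrectAt.congr (h : ∀ β ≤ α, d β = d' β) (hα : IsCorrectAt C B d α) :
    IsCorrectAt C B d' α := by
  have h' : ∀ β ≤ α, d' β = d β := fun β hβ => (h β hβ).symm
  refine ⟨?_, fun γ hγ => ?_, fun hsep γ hγ => ?_, fun hg K Q hQ hN => ?_,
    fun β hβ hg K Q hQ hN G hG => ?_⟩
  · rw [← h α le_rfl]
    exact hα.nonempty
  · rw [← h α le_rfl, ← h γ hγ.le]
    exact hα.disjoint γ hγ
  · rw [← mem_subbaseSet_congr (h α le_rfl)]
    exact hα.notMem (hsep.congr fun β hβ => h' β hβ.le) γ hγ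
  · obtain ⟨F, hF, hFN⟩ := hα.piNetwork (hg.congr fun β hβ => h' β hβ.le) K Q hQ
      ((mem_basicSet_congr (h α le_rfl)).2 hN)
    exact ⟨F, hF, fun y hy => (mem_basicSet_congr
      (h y (mem_Iio.1 (hg.subset_Iio F hF hy)).le)).1 (hFN hy)⟩
  · obtain ⟨F, hF, hFN, hFG⟩ := hα.omegaCover β hβ
      (hg.congr fun γ hγ => h' γ (hγ.le.trans hβ.le)) K Q hQ
      ((mem_basicSet_congr (h β hβ.le)).2 hN) G hG
    exact ⟨F, hF, fun y hy => (mem_basicSet_congr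
      (h y ((mem_Iio.1 (hg.subset_Iio F hF hy)).le.trans hβ.le))).1 (hFN hy), fun γ hγ y hy =>
      (mem_subbaseSet_congr (h y (hG hy).2)).1 (hFG γ hγ hy)⟩

/-- Finite sets below `α` are dealt with at their maximum, and the empty set at `β` itself. -/
theorem exists_cover_below (ih : ∀ β < α, IsCorrectAt C B d β) {β : OmegaOne} (hβ : β < α)
    (hg : IsGuessed B d β) {K : Finset OmegaOne} {Q : Set ℝ} (hQ : IsOpen Q)
    (hN : β ∈ basicSet d K Q) {E : Finset OmegaOne} (hE : (E : Set OmegaOne) ⊆ Ioo β α) :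
    ∃ F ∈ B β, (F : Set OmegaOne) ⊆ basicSet d K Q ∧
      ∀ γ ∈ F, (E : Set OmegaOne) ⊆ subbaseSet d γ := by
  rcases E.eq_empty_or_nonempty with rfl | hne
  · obtain ⟨F, hF, hFN⟩ := (ih β hβ).piNetwork hg K Q hQ hN
    exact ⟨F, hF, hFN, by simp⟩
  · have hmax := hE (E.max'_mem hne)
    exact (ih _ hmax.2).omegaCover β hmax.1 hg K Q hQ hN E fun x hx =>
      ⟨(hE hx).1, E.le_max' x hx⟩

/-- The values to be taken at `α`, before `C_α` is considered. -/
theorem exists_candidate (hB : IsDiamondSequenceOnFinsets B)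
    (ih : ∀ β < α, IsCorrectAt C B d β) :
    ∃ (H : Finset ℝ) (D : Set OmegaOne), D ⊆ Iio α ∧ H.Nonempty ∧
      (∀ γ < α, Disjoint (d γ).1 H) ∧
      (IsGuessed B d α → ∀ K : Finset OmegaOne, (K : Set OmegaOne) ⊆ D → ∀ Q : Set ℝ, IsOpen Q →
        (H : Set ℝ) ⊆ Q → ∃ F ∈ B α, (F : Set OmegaOne) ⊆ basicSet d K Q) ∧
      ∀ β < α, IsGuessed B d β → ∀ (K : Finset OmegaOne) (Q : Set ℝ), IsOpen Q →
        β ∈ basicSet d K Q → ∀ G : Finset OmegaOne, (G : Set OmegaOne) ⊆ Ioo β α →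
        ∃ F ∈ B β, (F : Set OmegaOne) ⊆ basicSet d K Q ∧ (F : Set OmegaOne) ⊆ D ∧
          ∀ γ ∈ F, (G : Set OmegaOne) ⊆ subbaseSet d γ := by
  by_cases hg : IsGuessed B d α
  · obtain ⟨-, hpd, hsub, θ, M, hMc, hM⟩ := id hg
    have hdisj : (Iio α).PairwiseDisjoint fun y => (d y).1 := by
      intro x hx y hy hxy
      rcases lt_or_gt_of_ne hxy with h | h
      · exact (ih y hy).disjoint x h
      · exact ((ih x hx).disjoint y h).symm
    obtain ⟨H, D, hD, hH, hHd, h1, h2⟩ := exists_generic_point (U := subbaseSet d) hB hpd hsub hMc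
      hM (fun γ hγ => (ih γ hγ).nonempty) hdisj
    refine ⟨H, D, hD, hH, hHd, fun _ => h1, fun β hβ hgβ K Q hQ hN G hG => ?_⟩
    obtain ⟨s, hs1, hs2⟩ := exists_ratIntervals (d β).1 hQ hN.2
    have hso : IsOpen (⋃ p ∈ s, ratInterval p) :=
      isOpen_iUnion fun p => isOpen_iUnion fun _ => isOpen_Ioo
    have hsc : (⋃ p ∈ s, ratInterval p) ⊆ ratCover s :=
      iUnion₂_mono fun p _ => Ioo_subset_Ioc_self
    obtain ⟨F, hF, hFN, hFD, hFG⟩ := h2 β hβ hgβ.subset_Iio (K.filter (· < α))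
      (fun γ hγ => (Finset.mem_filter.1 (Finset.mem_coe.1 hγ)).2) s G hG fun E hE => by
        obtain ⟨F, hF, hFN, hFE⟩ := exists_cover_below ih hβ hgβ hso
          ((mem_basicSet_filter hβ.le).2 ⟨hN.1, hs1⟩) hE
        exact ⟨F, hF, fun y hy => basicNhd_mono hsc (hFN hy), hFE⟩
    refine ⟨F, hF, fun y hy => ?_, hFD, hFG⟩
    exact (mem_basicSet_filter (hD (hFD hy)).le).1 (basicNhd_mono hs2 (hFN hy))
  · have hc : (⋃ γ ∈ Iio α, ((d γ).1 : Set ℝ)).Countable :=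
      (OmegaOne.countable_Iio α).biUnion fun γ _ => (d γ).1.countable_toSet
    obtain ⟨x, hx⟩ := (hc.dense_compl ℝ).nonempty
    refine ⟨{x}, Iio α, Subset.rfl, by simp, fun γ hγ => ?_, fun h => absurd h hg,
      fun β hβ hgβ K Q hQ hN G hG => ?_⟩
    · rw [Finset.disjoint_singleton_right]
      exact fun h => hx (mem_biUnion (show γ ∈ Iio α from hγ) h)
    · obtain ⟨F, hF, hFN, hFG⟩ := exists_cover_below ih hβ hgβ hQ hN hG
      exact ⟨F, hF, hFN, fun y hy => mem_Iio.2 ((mem_Iio.1 (hgβ.subset_Iio F hF hy)).trans hβ), hFG⟩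

theorem IsCorrectAt.exists_update (hC : ∀ α, C α ⊆ Iio α) (hB : IsDiamondSequenceOnFinsets B)
    (ih : ∀ β < α, IsCorrectAt C B d β) :
    ∃ e, IsCorrectAt C B (Function.update d α e) α := by
  obtain ⟨H, D, hD, hH, hHd, h1, h2⟩ := exists_candidate hB ih
  -- If `C_α` could become closed discrete, the new point is kept out of all `U_γ`, `γ ∈ C_α`.
  refine ⟨(H, {γ ∈ D | SeparatesBelow C d α → γ ∉ C α}), ?_⟩
  generalize hd' : Function.update d α (H, {γ ∈ D | SeparatesBelow C d α → γ ∉ C α}) = d'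
  have hα : d' α = (H, {γ ∈ D | SeparatesBelow C d α → γ ∉ C α}) := by
    rw [← hd', Function.update_self]
  have hlt : ∀ β < α, d' β = d β := fun β hβ => by rw [← hd', Function.update_of_ne hβ.ne]
  have hmem : ∀ γ < α, α ∈ subbaseSet d' γ ↔ γ ∈ D ∧ (SeparatesBelow C d α → γ ∉ C α) :=
    fun γ hγ => by
      simp only [subbaseSet, mem_ofPred_eq, hα, not_le.2 hγ, false_or]
  refine ⟨?_, fun γ hγ => ?_, fun hsep γ hγ hmemγ => ?_, fun hg K Q hQ hN => ?_,
    fun β hβ hg K Q hQ hN G hG => ?_⟩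
  · rw [hα]
    exact hH
  · rw [hα, hlt γ hγ]
    exact hHd γ hγ
  · exact ((hmem γ (hC α hγ)).1 hmemγ).2 (hsep.congr hlt) hγ
  · have hK : ((K.filter (· < α) : Finset OmegaOne) : Set OmegaOne) ⊆ D := fun γ hγ => by
      obtain ⟨hγK, hγα⟩ := Finset.mem_filter.1 (Finset.mem_coe.1 hγ)
      exact ((hmem γ hγα).1 (hN.1 γ hγK)).1
    obtain ⟨F, hF, hFN⟩ := h1 (hg.congr hlt) _ hK Q hQ (by simpa only [hα] using hN.2)
    refine ⟨F, hF, fun y hy => ?_⟩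
    have hyα : y < α := hg.subset_Iio F hF hy
    exact (mem_basicSet_congr (hlt y hyα)).2 ((mem_basicSet_filter hyα.le).1 (hFN hy))
  · classical
    have hgd : IsGuessed B d β := hg.congr fun γ hγ => hlt γ (hγ.trans hβ)
    have hNd : β ∈ basicSet d K Q := (mem_basicSet_congr (hlt β hβ)).1 hN
    have hG' : ((G.erase α : Finset OmegaOne) : Set OmegaOne) ⊆ Ioo β α := fun y hy => by
      obtain ⟨hyα, hyG⟩ := Finset.mem_erase.1 (Finset.mem_coe.1 hy)
      exact ⟨(hG hyG).1, lt_of_le_of_ne (hG hyG).2 hyα⟩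
    obtain ⟨F, hF, hFN, hFD, hFG⟩ : ∃ F ∈ B β, (F : Set OmegaOne) ⊆ basicSet d K Q ∧
        (∀ γ ∈ F, γ ∈ D ∧ (SeparatesBelow C d α → γ ∉ C α)) ∧
        ∀ γ ∈ F, ((G.erase α : Finset OmegaOne) : Set OmegaOne) ⊆ subbaseSet d γ := by
      by_cases hsep : SeparatesBelow C d α
      · -- Members of `B_β` inside a neighbourhood of `β` that meets `C_α` at most in `β` miss `C_α`.
        obtain ⟨K', Q', hQ', hN', hsepβ⟩ := hsep β hβ
        obtain ⟨F, hF, hFN, hFD, hFG⟩ := h2 β hβ hgd (K ∪ K') (Q ∩ Q') (hQ.inter hQ')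
          (basicSet_inter.2 ⟨hNd, hN'⟩) _ hG'
        refine ⟨F, hF, fun y hy => (basicSet_inter.1 (hFN hy)).1, fun γ hγ => ⟨hFD hγ, ?_⟩, hFG⟩
        intro _ hγC
        have hγβ : γ < β := hg.subset_Iio F hF hγ
        exact hγβ.ne (hsepβ γ (hγβ.trans hβ) (basicSet_inter.1 (hFN hγ)).2 hγC)
      · obtain ⟨F, hF, hFN, hFD, hFG⟩ := h2 β hβ hgd K Q hQ hNd _ hG'
        exact ⟨F, hF, hFN, fun γ hγ => ⟨hFD hγ, fun h => absurd h hsep⟩, hFG⟩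
    refine ⟨F, hF, fun y hy => ?_, fun γ hγ y hy => ?_⟩
    · have hyα : y < α := (mem_Iio.1 (hg.subset_Iio F hF hy)).trans hβ
      exact (mem_basicSet_congr (hlt y hyα)).2 (hFN hy)
    · have hγα : γ < α := hD (hFD γ hγ).1
      rcases (hG hy).2.lt_or_eq with hyα | rfl
      · exact (mem_subbaseSet_congr (hlt y hyα)).2
          (hFG γ hγ (Finset.mem_coe.2 (Finset.mem_erase.2 ⟨hyα.ne, hy⟩)))
      · exact (hmem γ hγα).2 (hFD γ hγ)

theorem exists_forall_isCorrectAt (hC : ∀ α, C α ⊆ Iio α) (hB : IsDiamondSequenceOnFinsets B) :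
    ∃ d, ∀ α, IsCorrectAt C B d α :=
  exists_forall_of_extend (fun α d => IsCorrectAt C B d α) (fun _ _ _ h => IsCorrectAt.congr h)
    fun _ _ ih => IsCorrectAt.exists_update hC hB ih

/-! ### The topologies `τ_α` -/

/-- The basic sets, restricted to `α + 1`, refine the open sets of `τ_α`. -/
theorem exists_basicSet_subset {V : Set (Iic α)}
    (hV : IsOpen[tau (fun α γ => subbaseSet d γ ∩ Iic α) (fun _ y => (d y).1) α] V)
    {x : Iic α} (hx : x ∈ V) :
    ∃ (K : Finset OmegaOne) (Q : Set ℝ), IsOpen Q ∧ (x : OmegaOne) ∈ basicSet d K Q ∧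
      ∀ y : Iic α, (y : OmegaOne) ∈ basicSet d K Q → y ∈ V := by
  classical
  induction hV generalizing x with
  | basic S hS =>
    rcases hS with ⟨γ, -, rfl⟩ | ⟨W, ⟨s, -, rfl⟩, rfl⟩
    · refine ⟨{γ}, univ, isOpen_univ, ⟨fun δ hδ => ?_, subset_univ _⟩, fun y hy => ?_⟩
      · rw [Finset.mem_singleton.1 hδ]
        exact hx.1
      · exact ⟨hy.1 γ (Finset.mem_singleton_self γ), y.2⟩
    · exact ⟨∅, _, isOpen_iUnion fun p => isOpen_iUnion fun _ => isOpen_Ioo,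
        ⟨by simp, hx⟩, fun y hy => hy.2⟩
  | univ => exact ⟨∅, univ, isOpen_univ, ⟨by simp, subset_univ _⟩, fun _ _ => mem_univ _⟩
  | inter S T _ _ ihS ihT =>
    obtain ⟨K, Q, hQ, hxN, hN⟩ := ihS hx.1
    obtain ⟨K', Q', hQ', hxN', hN'⟩ := ihT hx.2
    exact ⟨K ∪ K', Q ∩ Q', hQ.inter hQ', basicSet_inter.2 ⟨hxN, hxN'⟩, fun y hy =>
      ⟨hN y (basicSet_inter.1 hy).1, hN' y (basicSet_inter.1 hy).2⟩⟩
  | sUnion 𝒮 _ ih =>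
    obtain ⟨S, hS, hxS⟩ := hx
    obtain ⟨K, Q, hQ, hxN, hN⟩ := ih S hS hxS
    exact ⟨K, Q, hQ, hxN, fun y hy => ⟨S, hS, hN y hy⟩⟩

theorem separatesBelow_of_isClosedDiscrete
    (h : IsClosedDiscrete (tau (fun α γ => subbaseSet d γ ∩ Iic α) (fun _ y => (d y).1) α)
      {x : Iic α | (x : OmegaOne) ∈ C α}) : SeparatesBelow C d α := fun x hx => by
  let := tau (fun α γ => subbaseSet d γ ∩ Iic α) (fun _ y => (d y).1) α
  let x' : Iic α := ⟨x, hx.le⟩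
  have hcl : IsClosed ({x : Iic α | (x : OmegaOne) ∈ C α} \ {x'}) :=
    isClosed_of_subset_discrete_closed sdiff_subset h.2 h.1
  obtain ⟨K, Q, hQ, hxN, hN⟩ := exists_basicSet_subset (x := x') hcl.isOpen_compl fun h => h.2 rfl
  refine ⟨K, Q, hQ, hxN, fun y hy hyN hyC => ?_⟩
  by_contra hne
  exact hN ⟨y, hy.le⟩ hyN ⟨hyC, fun h => hne (congrArg Subtype.val h)⟩

end Construction

/-! ### The construction -/

theorem mainTheorem2 (hDiamond : DiamondPrinciple) :
    (∃ C : OmegaOne → Set OmegaOne, EnumeratesCountableSets C) ∧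
    (∃ B : OmegaOne → Set (Finset OmegaOne), IsDiamondSequenceOnFinsets B) ∧
    ∀ (C : OmegaOne → Set OmegaOne) (B : OmegaOne → Set (Finset OmegaOne)),
      EnumeratesCountableSets C → IsDiamondSequenceOnFinsets B →
      ∃ (U : OmegaOne → OmegaOne → Set OmegaOne) (φ : OmegaOne → OmegaOne → Finset ℝ),
        -- IH(1)
        ((∀ α, ∀ γ ≤ α, U α γ ⊆ Iic α) ∧ (∀ α, U α α = Iic α) ∧
          (∀ α, ∀ γ ≤ α, (φ α γ).Nonempty) ∧
          (∀ α, (Iic α).PairwiseDisjoint (φ α))) ∧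
        -- IH(2)
        (∀ γ α α₀, γ ≤ α → α ≤ α₀ → U α γ = U α₀ γ ∩ Iic α ∧ φ α γ = φ α₀ γ) ∧
        -- IH(3)
        (∀ α, IsClosedDiscrete (tau U φ α) {x : Iic α | (x : OmegaOne) ∈ C α} →
          (⋃ γ ∈ C α, U α γ) ≠ Iic α) ∧
        -- IH(4)(a)
        (∀ α β, ∀ hβ : β ≤ α, β ∈ guessedPoints B U φ α →
          IsLocalPiNetwork (tau U φ α)
            {N | ∃ F ∈ B β, N = {x : Iic α | (x : OmegaOne) ∈ F}} ⟨β, hβ⟩) ∧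
        -- IH(4)(b)
        (∀ α β, ∀ hβ : β < α, β ∈ guessedPoints B U φ α →
          ∀ V : Set (Iic α), IsOpen[tau U φ α] V → (⟨β, hβ.le⟩ : Iic α) ∈ V →
            IsOmegaCover
              {S | ∃ F ∈ B β, (F : Set OmegaOne) ⊆ Subtype.val '' V ∧ S = interU U α F}
              (Ioc β α)) := by
  refine ⟨hDiamond.exists_enumeratesCountableSets, hDiamond.exists_isDiamondSequenceOnFinsets,
    fun C B hC hB => ?_⟩
  obtain ⟨d, hd⟩ := exists_forall_isCorrectAt hC.2 hB
  refine ⟨fun α γ => subbaseSet d γ ∩ Iic α, fun _ y => (d y).1,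
    ⟨fun _ _ _ => inter_subset_right, fun α => inter_eq_right.2 fun _ hx => Or.inl hx,
      fun _ γ _ => (hd γ).nonempty, fun α x _ y _ hxy => ?_⟩, fun γ α α₀ _ hα => ⟨?_, rfl⟩,
    fun α hcd hU => ?_, fun α β hβ hg V hV hβV => ?_, fun α β hβ hg V hV hβV G hG => ?_⟩
  · rcases lt_or_gt_of_ne hxy with h | h
    · exact (hd y).disjoint x h
    · exact ((hd x).disjoint y h).symm
  · rw [inter_assoc, Iic_inter_Iic, min_eq_right hα]
  · have h : α ∈ ⋃ γ ∈ C α, subbaseSet d γ ∩ Iic α :=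
      (Set.ext_iff.1 hU α).2 self_mem_Iic
    simp only [mem_iUnion, exists_prop] at h
    obtain ⟨γ, hγ, hαγ, -⟩ := h
    exact (hd α).notMem (separatesBelow_of_isClosedDiscrete hcd) γ hγ hαγ
  · have hgβ : IsGuessed B d β := ⟨le_rfl, hg.2⟩
    obtain ⟨K, Q, hQ, hβN, hN⟩ := exists_basicSet_subset hV hβV
    obtain ⟨F, hF, hFN⟩ := (hd β).piNetwork hgβ K Q hQ hβN
    exact ⟨_, ⟨F, hF, rfl⟩, fun y hy => hN y (hFN hy)⟩
  · have hgβ : IsGuessed B d β := ⟨le_rfl, hg.2⟩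
    obtain ⟨K, Q, hQ, hβN, hN⟩ := exists_basicSet_subset hV hβV
    obtain ⟨F, hF, hFN, hFG⟩ := (hd α).omegaCover β hβ hgβ K Q hQ hβN G hG
    refine ⟨_, ⟨F, hF, fun y hy => ?_, rfl⟩, fun y hy => ⟨(hG hy).2, fun γ hγ =>
      ⟨hFG γ hγ hy, (hG hy).2⟩⟩⟩
    have hyα : y ≤ α := (mem_Iio.1 (hgβ.subset_Iio F hF hy)).le.trans hβ.le
    exact ⟨⟨y, hyα⟩, hN ⟨y, hyα⟩ (hFN hy), rfl⟩
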